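/- Let $0<\alpha<1$ and let $\mathcal{C}_\alpha[-\pi,\pi)$ be the set of functions $f$ on $[-\pi,\pi)$ with $\sup_{\omega\ne\tau}|f(\omega)-f(\tau)|/|\omega-\tau|^{\alpha}<\infty$ and $f(-\pi)=\lim_{\omega\to\pi^-}f(\omega)$. Let $\Phi\in\mathcal{C}_\alpha[-\pi,\pi)$ be real valued with $\Phi(\omega)>0$ for all $\omega$, and let $\Psi\in\mathcal{C}_\alpha[-\pi,\pi)$ be complex valued. For $|z|<1$ put $$\Phi_+(z)=\exp\Big(\frac{1}{4\pi}\int_{-\pi}^{\pi}\log\Phi(\tau)\,\frac{e^{i\tau}+z}{e^{i\tau}-z}\,d\tau\Big)$$ (the analytic square root of the outer function of $\Phi$ that is positive at $0$), and for $|z|>1$ put $\Phi_-(z)=\overline{\Phi_+(1/\overline z)}$. Then for every $\omega\in[-\pi,\pi)$ the radial limits $\Phi_+(e^{i\omega})=\lim_{r\to1^-}\Phi_+(re^{i\omega})$ and $\Phi_-(e^{i\omega})=\lim_{r\to1^+}\Phi_-(re^{i\omega})$ exist, and $\Phi(\omega)=\Phi_+(e^{i\omega})\Phi_-(e^{i\omega})$.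 Put $\Gamma(\omega)=\Psi(\omega)/\Phi_-(e^{i\omega})$ and define, for $|z|<1$, the whitening filter $H_W(z)=1/\Phi_+(z)$, the estimation filter $$H_E(z)=\sum_{k=0}^{\infty}\gamma_kz^k,\qquad \gamma_k=\frac1{2\pi}\int_{-\pi}^{\pi}\Gamma(\tau)e^{-ik\tau}\,d\tau,$$ and the Wiener filter $H_WH_E$. Write $\|f\|_\infty=\sup_{|z|<1}|f(z)|$. Theorem. Let $H(z)=\sum_{k\ge0}H_kz^k$ be any one of the whitening, the estimation and the Wiener filter. Then there is a constant $C$, independent of $N$, such that for every integer $N\ge1$: (1) there is a polynomial $H_N$ of degree at most $N$ (an FIR filter) with $\|H-H_N\|_\infty\le C N^{-\alpha}$; (2) the de la Vallée-Poussin mean $V_N(z;H)=2F_{2N-1}(z;H)-F_{N-1}(z;H)$, where $F_M(z;H)=\sum_{k=0}^{M}\big(1-\frac{k}{M+1}\big)H_kz^k$ is the Fejér mean (so that $V_N$ is a polynomial of degree at most $2N-1$), satisfies $\|H-V_N(\cdot\,;H)\|_\infty\le C N^{-\alpha}$. -/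

import Mathlib

open Filter Topology
open scoped NNReal ENNReal Polynomial Nat ComplexConjugate

noncomputable section

namespace WienerFIR

/-- The Hölder space of order `α` over `[-π, π)`; as for every function space over this interval,
the value at `-π` is the limit at `π`, so that the function is continuous on the circle.
Only the values of `f` on `[-π, π)` matter. -/
def HolderSpectrum {E : Type*} [NormedAddCommGroup E] (α : ℝ≥0) (f : ℝ → E) : Prop :=
  (∃ C : ℝ≥0, HolderOnWith C α f (Set.Ico (-Real.pi) Real.pi)) ∧
    Tendsto f (𝓝[<] Real.pi) (𝓝 (f (-Real.pi)))

/-- The point `e^{iω}` of the unit circle. -/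
def circlePt (ω : ℝ) : ℂ := Complex.exp (Complex.I * ω)

/-- The integral transform whose exponential is the outer function of `Φ`. -/
def outerExponent (Φ : ℝ → ℝ) (z : ℂ) : ℂ :=
  (1 / (2 * (Real.pi : ℂ))) *
    ∫ τ in (-Real.pi)..Real.pi,
      (Real.log (Φ τ) : ℂ) * ((circlePt τ + z) / (circlePt τ - z))

/-- The outer function `F₊` of `Φ` in the unit disk. -/
def outerFunction (Φ : ℝ → ℝ) (z : ℂ) : ℂ := Complex.exp (outerExponent Φ z)

/-- The spectral factor `Φ₊ = F₊ ^ (1/2)` in the unit disk. The square root is the analytic branch,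
positive at the origin (the principal branch of the complex power would in general not be
analytic). -/
def factorPlus (Φ : ℝ → ℝ) (z : ℂ) : ℂ := Complex.exp (outerExponent Φ z / 2)

theorem factorPlus_sq (Φ : ℝ → ℝ) (z : ℂ) : factorPlus Φ z ^ 2 = outerFunction Φ z := by
  unfold factorPlus outerFunction
  rw [← Complex.exp_nat_mul]
  congr 1
  push_cast
  ring

/-- The spectral factor `Φ₋` outside the closed unit disk. -/
def factorMinus (Φ : ℝ → ℝ) (z : ℂ) : ℂ := conj (factorPlus Φ (1 / conj z))

/-- The boundary value `Φ₊(e^{iω})`, a radial limit from inside the disk. -/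
def factorPlusBdry (Φ : ℝ → ℝ) (ω : ℝ) : ℂ :=
  limUnder (𝓝[<] (1 : ℝ)) fun r : ℝ => factorPlus Φ (r * circlePt ω)

/-- The boundary value `Φ₋(e^{iω})`, a radial limit from outside the disk. -/
def factorMinusBdry (Φ : ℝ → ℝ) (ω : ℝ) : ℂ :=
  limUnder (𝓝[>] (1 : ℝ)) fun r : ℝ => factorMinus Φ (r * circlePt ω)

/-- The positive-time part `Γ⁺(z) = ∑_{k ≥ 0} γ_k z^k`, where
`γ_k = (1/2π) ∫_{-π}^{π} Γ(τ) e^{-ikτ} dτ`. -/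
def positivePart (Γ : ℝ → ℂ) (z : ℂ) : ℂ :=
  ∑' k : ℕ, fourierCoeffOn (neg_lt_self Real.pi_pos) Γ (k : ℤ) * z ^ k

/-- The whitening filter. -/
def whiteningFilter (Φ : ℝ → ℝ) (z : ℂ) : ℂ := 1 / factorPlus Φ z

/-- The estimation filter. -/
def estimationFilter (Φ : ℝ → ℝ) (Ψ : ℝ → ℂ) : ℂ → ℂ :=
  positivePart fun ω => Ψ ω / factorMinusBdry Φ ω

/-- The causal Wiener filter. -/
def wienerFilter (Φ : ℝ → ℝ) (Ψ : ℝ → ℂ) (z : ℂ) : ℂ :=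
  whiteningFilter Φ z * estimationFilter Φ Ψ z

/-- The norm `‖f‖_∞ = sup_{|z| < 1} |f z|`, with value `∞` if `f` is unbounded in the disk. -/
def diskNorm (f : ℂ → ℂ) : ℝ≥0∞ := ⨆ z ∈ Metric.ball (0 : ℂ) 1, ‖f z‖ₑ

/-- The coefficient `H_k` of the power series of `H` at the origin. -/
def powerCoeff (H : ℂ → ℂ) (k : ℕ) : ℂ := iteratedDeriv k H 0 / (k ! : ℂ)

/-- The Fejér mean `F_N(·; H)`. -/
def fejerMean (H : ℂ → ℂ) (N : ℕ) : ℂ[X] :=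
  ∑ k ∈ Finset.range (N + 1),
    Polynomial.C ((1 - (k : ℂ) / ((N : ℂ) + 1)) * powerCoeff H k) * Polynomial.X ^ k

/-- The de la Vallée-Poussin mean `V_N(·; H)`, for `N ≥ 1`. -/
def valleePoussinMean (H : ℂ → ℂ) (N : ℕ) : ℂ[X] :=
  2 * fejerMean H (2 * N - 1) - fejerMean H (N - 1)

end WienerFIR

end

open WienerFIR

/-! The rate comes from one fact: if `H` is analytic in the disk and Hölder of order `a` there, `0 <
a < 1`, then its Fejér means converge at rate `N ^ (-a)` (`exists_norm_sub_fejerMean_le`). The de la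
Vallée-Poussin mean is twice one Fejér mean minus another, so it inherits the rate.

It remains to see that the three filters are analytic and Hölder in the disk. Since `Φ` is bounded
below, `log Φ` is Hölder on the circle. Its Herglotz integral is, up to constants, a Cauchy
transform, and the Cauchy transform preserves Hölder classes (Privalov,
`HolderAlong.cauchyTransform`): the derivative is `O((1 - |z|) ^ (a - 1))`, which gives Hölder
continuity by Hardy and Littlewood. Exponentials keep the class, so `Φ₊` and `1 / Φ₊` are Hölder and
have Hölder boundary values. Hence `Γ`, the product of `Ψ` and the conjugate boundary value of `1 /
Φ₊`, is Hölder; the estimation filter is its Cauchy transform, and the Wiener filter is a product of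
Hölder functions.

A single estimate, `exists_integral_chord_le`, controls the differentiated Cauchy kernel, the
Poisson kernel and the Fejér kernel. Its constant contains `1 / (1 - a)`, which is where `a < 1`
enters. -/

noncomputable section

namespace WienerFIR

/-! ### Hölder functions along a map into the plane -/

/-- `u` is Hölder of order `a` on `s` with respect to the distance of the images under `p`. -/
def HolderAlong {X E : Type*} [NormedAddCommGroup E] (p : X → ℂ) (s : Set X) (a : ℝ)
    (u : X → E) : Prop :=
  ∃ K : ℝ, 0 ≤ K ∧ ∀ x ∈ s, ∀ y ∈ s, ‖u x - u y‖ ≤ K * ‖p x - p y‖ ^ a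

namespace HolderAlong

variable {X E : Type*} [NormedAddCommGroup E] {p : X → ℂ} {s : Set X} {a : ℝ}

theorem congr {u v : X → E} (h : HolderAlong p s a u) (huv : ∀ x ∈ s, v x = u x) :
    HolderAlong p s a v := by
  obtain ⟨K, hK, h⟩ := h
  exact ⟨K, hK, fun x hx y hy => by rw [huv x hx, huv y hy]; exact h x hx y hy⟩

theorem exists_bound {u : X → E} (h : HolderAlong p s a u) (ha : 0 ≤ a)
    (hp : ∀ x ∈ s, ‖p x‖ ≤ 1) : ∃ B : ℝ, 0 ≤ B ∧ ∀ x ∈ s, ‖u x‖ ≤ B := by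
  obtain ⟨K, hK, h⟩ := h
  rcases s.eq_empty_or_nonempty with rfl | ⟨x₀, h₀⟩
  · exact ⟨0, le_rfl, fun x hx => hx.elim⟩
  · refine ⟨K * 2 ^ a + ‖u x₀‖, by positivity, fun x hx => ?_⟩
    have h1 : ‖p x - p x₀‖ ≤ 2 := (norm_sub_le _ _).trans (by linarith [hp x hx, hp x₀ h₀])
    calc ‖u x‖ = ‖(u x - u x₀) + u x₀‖ := by rw [sub_add_cancel]
      _ ≤ ‖u x - u x₀‖ + ‖u x₀‖ := norm_add_le _ _
      _ ≤ _ := by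
        gcongr
        exact (h x hx x₀ h₀).trans (by gcongr)

theorem mul {u v : X → ℂ} (hu : HolderAlong p s a u) (hv : HolderAlong p s a v) (ha : 0 ≤ a)
    (hp : ∀ x ∈ s, ‖p x‖ ≤ 1) : HolderAlong p s a (fun x => u x * v x) := by
  obtain ⟨A, hA0, hA⟩ := hu.exists_bound ha hp
  obtain ⟨B, hB0, hB⟩ := hv.exists_bound ha hp
  obtain ⟨K, hK, hu⟩ := hu
  obtain ⟨L, hL, hv⟩ := hv
  refine ⟨A * L + K * B, by positivity, fun x hx y hy => ?_⟩
  calc ‖u x * v x - u y * v y‖ = ‖u x * (v x - v y) + (u x - u y) * v y‖ := by ring_nf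
    _ ≤ ‖u x‖ * ‖v x - v y‖ + ‖u x - u y‖ * ‖v y‖ := by
      rw [← norm_mul, ← norm_mul]; exact norm_add_le _ _
    _ ≤ A * (L * ‖p x - p y‖ ^ a) + (K * ‖p x - p y‖ ^ a) * B := by
      gcongr
      · exact hA x hx
      · exact hv x hx y hy
      · exact hu x hx y hy
      · exact hB y hy
    _ = _ := by ring

/-- Composition with a function that is Lipschitz along `u`. -/
theorem lipschitz_comp {F : Type*} [NormedAddCommGroup F] {u : X → E} {v : X → F}
    (hu : HolderAlong p s a u) (L : ℝ) (hL : 0 ≤ L)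
    (h : ∀ x ∈ s, ∀ y ∈ s, ‖v x - v y‖ ≤ L * ‖u x - u y‖) : HolderAlong p s a v := by
  obtain ⟨K, hK, hu⟩ := hu
  refine ⟨L * K, by positivity, fun x hx y hy => (h x hx y hy).trans ?_⟩
  rw [mul_assoc]
  exact mul_le_mul_of_nonneg_left (hu x hx y hy) hL

theorem const_mul_add {u : X → ℂ} (hu : HolderAlong p s a u) (c d : ℂ) :
    HolderAlong p s a (fun x => c * u x + d) :=
  hu.lipschitz_comp ‖c‖ (norm_nonneg c) fun x _ y _ => by
    rw [← norm_mul]; exact le_of_eq (by congr 1; ring)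

theorem star_conj {u : X → ℂ} (hu : HolderAlong p s a u) :
    HolderAlong p s a (fun x => conj (u x)) :=
  hu.lipschitz_comp 1 zero_le_one fun x _ y _ => by
    rw [← map_sub, RCLike.norm_conj, one_mul]

/-- The values of `u` lie in a ball of some radius `B`, on which `exp` is Lipschitz with constant `e
^ B`. -/
theorem cexp {u : X → ℂ} (hu : HolderAlong p s a u) (ha : 0 ≤ a)
    (hp : ∀ x ∈ s, ‖p x‖ ≤ 1) : HolderAlong p s a (fun x => Complex.exp (u x)) := by
  obtain ⟨B, hB0, hB⟩ := hu.exists_bound ha hp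
  refine hu.lipschitz_comp (Real.exp B) (Real.exp_pos B).le fun x hx y hy => ?_
  refine (convex_closedBall (0 : ℂ) B).norm_image_sub_le_of_norm_deriv_le
    (f := Complex.exp) (fun z _ => Complex.differentiableAt_exp) (fun z hz => ?_)
    (mem_closedBall_zero_iff.2 (hB y hy)) (mem_closedBall_zero_iff.2 (hB x hx))
  rw [Complex.deriv_exp]
  exact (Complex.norm_exp_le_exp_norm z).trans
    (Real.exp_le_exp.2 (mem_closedBall_zero_iff.1 hz))

end HolderAlong

/-! ### Chords of the unit circle -/

theorem circlePt_sub (x y : ℝ) : circlePt (x - y) = circlePt x / circlePt y := by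
  simp only [circlePt, ← Complex.exp_sub]; congr 1; push_cast; ring

theorem norm_circlePt (x : ℝ) : ‖circlePt x‖ = 1 := by
  rw [circlePt, mul_comm, Complex.norm_exp_ofReal_mul_I]

theorem circlePt_ne_zero (x : ℝ) : circlePt x ≠ 0 := Complex.exp_ne_zero _

theorem continuous_circlePt : Continuous circlePt := by unfold circlePt; fun_prop

theorem circlePt_periodic : Function.Periodic circlePt (2 * Real.pi) := fun x => by
  have := Complex.exp_periodic (Complex.I * x)
  simp only [circlePt]; rw [← this]; congr 1; push_cast; ring

theorem conj_circlePt (x : ℝ) : conj (circlePt x) = (circlePt x)⁻¹ := by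
  rw [Complex.inv_def, Complex.normSq_eq_norm_sq, norm_circlePt]; simp

theorem chord_eq (x y : ℝ) : ‖circlePt x - circlePt y‖ = ‖circlePt (x - y) - 1‖ := by
  rw [circlePt_sub, div_sub_one (circlePt_ne_zero y), norm_div, norm_circlePt y, div_one]

/-- Jordan's inequality for the sine, as the chord has length `2 |sin (t / 2)|`. -/
theorem abs_le_chord {t : ℝ} (ht : |t| ≤ Real.pi) :
    2 / Real.pi * |t| ≤ ‖circlePt t - 1‖ := by
  rw [circlePt, Complex.norm_exp_I_mul_ofReal_sub_one, norm_mul, Real.norm_eq_abs,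
    Real.norm_eq_abs, abs_two]
  have h := Real.mul_abs_le_abs_sin (x := t / 2) (by rw [abs_div, abs_two]; linarith)
  rw [abs_div, abs_two] at h
  linarith

/-- Every point of the plane in polar coordinates with angle in `[-π, π)`. -/
theorem exists_eq_norm_mul_circlePt (z : ℂ) :
    ∃ θ ∈ Set.Ico (-Real.pi) Real.pi, z = ‖z‖ * circlePt θ := by
  -- `arg` takes values in `(-π, π]`; conjugating and negating moves the included endpoint to `-π`.
  refine ⟨-Complex.arg (conj z), ⟨?_, ?_⟩, ?_⟩
  · linarith [Complex.arg_le_pi (conj z)]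
  · linarith [Complex.neg_pi_lt_arg (conj z)]
  · have h := congrArg conj (Complex.norm_mul_exp_arg_mul_I (conj z))
    rw [map_mul, ← Complex.exp_conj, Complex.conj_conj, RCLike.norm_conj] at h
    simp only [map_mul, Complex.conj_ofReal, Complex.conj_I] at h
    refine h.symm.trans ?_
    rw [circlePt]
    congr 2
    push_cast
    ring

theorem integral_comp_chord (g : ℝ → ℝ) (θ : ℝ) :
    ∫ τ in (-Real.pi)..Real.pi, g ‖circlePt τ - circlePt θ‖ =
      ∫ t in (-Real.pi)..Real.pi, g ‖circlePt t - 1‖ := by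
  have hper : Function.Periodic (fun t => g ‖circlePt t - 1‖) (2 * Real.pi) := fun t => by
    simp only [circlePt_periodic t]
  have h := hper.intervalIntegral_add_eq (-Real.pi - θ) (-Real.pi)
  rw [show -Real.pi - θ + 2 * Real.pi = Real.pi - θ by ring,
    show -Real.pi + 2 * Real.pi = Real.pi by ring] at h
  rw [← h, ← intervalIntegral.integral_comp_sub_right (fun t => g ‖circlePt t - 1‖) θ]
  simp only [chord_eq]

/-- The antiderivative is explicit, and its value at `T` has the sign that allows dropping it. -/
theorem integral_add_mul_rpow_le {a c δ : ℝ} (ha1 : a < 1) (hc : 0 < c) (hδ : 0 < δ) {T : ℝ}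
    (hT : 0 ≤ T) : ∫ t in (0 : ℝ)..T, (δ + c * t) ^ (a - 2) ≤ δ ^ (a - 1) / (c * (1 - a)) := by
  have hpos : ∀ t ∈ Set.uIcc 0 T, 0 < δ + c * t := fun t ht => by
    rw [Set.uIcc_of_le hT] at ht
    have := mul_nonneg hc.le ht.1
    linarith
  have hd : ∀ t ∈ Set.uIcc 0 T,
      HasDerivAt (fun t => -(δ + c * t) ^ (a - 1) / (c * (1 - a))) ((δ + c * t) ^ (a - 2)) t := by
    intro t ht
    have h1 : HasDerivAt (fun t => δ + c * t) c t := by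
      simpa using ((hasDerivAt_id t).const_mul c).const_add δ
    have h2 := ((h1.rpow_const (p := a - 1) (Or.inl (hpos t ht).ne')).neg).div_const (c * (1 - a))
    convert! h2 using 1
    rw [show a - 1 - 1 = a - 2 by ring]
    have : 1 - a ≠ 0 := by linarith
    field_simp
    ring
  have hcont : ContinuousOn (fun t => (δ + c * t) ^ (a - 2)) (Set.uIcc 0 T) := fun t ht =>
    ((by fun_prop : Continuous fun t => δ + c * t).continuousAt.rpow_const
      (Or.inl (hpos t ht).ne')).continuousWithinAt
  rw [intervalIntegral.integral_eq_sub_of_hasDerivAt hd hcont.intervalIntegrable]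
  have h3 : 0 ≤ (δ + c * T) ^ (a - 1) / (c * (1 - a)) :=
    div_nonneg (Real.rpow_nonneg (by positivity) _) (mul_nonneg hc.le (by linarith))
  simp only [mul_zero, add_zero, neg_div]
  linarith

/-- The singular integral governing both the Poisson and the Fejér kernel. -/
theorem exists_integral_chord_le {a : ℝ} (ha0 : 0 < a) (ha1 : a < 1) :
    ∃ C : ℝ, 0 ≤ C ∧ ∀ δ : ℝ, 0 < δ → ∀ θ : ℝ,
      ∫ τ in (-Real.pi)..Real.pi, ‖circlePt τ - circlePt θ‖ ^ a *
        (δ / (δ + ‖circlePt τ - circlePt θ‖) ^ 2) ≤ C * δ ^ a := by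
  have hc : 0 < 2 / Real.pi := by positivity
  refine ⟨2 * (1 / (2 / Real.pi * (1 - a))),
    mul_nonneg zero_le_two (div_nonneg zero_le_one (mul_nonneg hc.le (by linarith))),
    fun δ hδ θ => ?_⟩
  rw [integral_comp_chord (fun x => x ^ a * (δ / (δ + x) ^ 2)) θ]
  have hcl : Continuous fun t => ‖circlePt t - 1‖ := by
    have := continuous_circlePt; fun_prop
  have hcr : Continuous fun t : ℝ => δ * (δ + 2 / Real.pi * |t|) ^ (a - 2) := by
    refine continuous_const.mul ?_
    refine Continuous.rpow_const (by fun_prop) fun t => Or.inl ?_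
    positivity
  calc ∫ t in (-Real.pi)..Real.pi, ‖circlePt t - 1‖ ^ a * (δ / (δ + ‖circlePt t - 1‖) ^ 2)
      ≤ ∫ t in (-Real.pi)..Real.pi, δ * (δ + 2 / Real.pi * |t|) ^ (a - 2) := by
        refine intervalIntegral.integral_mono_on (by linarith [Real.pi_pos]) ?_
          (hcr.intervalIntegrable _ _) fun t ht => ?_
        · refine Continuous.intervalIntegrable ?_ _ _
          refine (hcl.rpow_const fun _ => Or.inr ha0.le).mul (Continuous.div (by fun_prop)
            (by fun_prop) fun t => ?_)
          positivity
        · have h1 := abs_le_chord (t := t) (abs_le.2 ht)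
          set x := ‖circlePt t - 1‖
          have hx : 0 ≤ x := norm_nonneg _
          -- Absorbing `x ^ a` leaves a single power with negative exponent, so the chord can then
          -- be replaced by its linear lower bound.
          calc x ^ a * (δ / (δ + x) ^ 2) ≤ (δ + x) ^ a * (δ / (δ + x) ^ 2) := by
                gcongr; linarith
            _ = δ * (δ + x) ^ (a - 2) := by
                rw [Real.rpow_sub (by positivity), Real.rpow_two]; ring
            _ ≤ _ := by
                refine mul_le_mul_of_nonneg_left ?_ hδ.le
                exact Real.rpow_le_rpow_of_nonpos (by positivity) (by linarith) (by linarith)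
    _ = δ * (2 * ∫ t in (0 : ℝ)..Real.pi, (δ + 2 / Real.pi * t) ^ (a - 2)) := by
        have hi := hcr.intervalIntegrable (μ := MeasureTheory.volume)
        have hpos : ∫ t in (0 : ℝ)..Real.pi, δ * (δ + 2 / Real.pi * |t|) ^ (a - 2) =
            δ * ∫ t in (0 : ℝ)..Real.pi, (δ + 2 / Real.pi * t) ^ (a - 2) := by
          rw [← intervalIntegral.integral_const_mul]
          refine intervalIntegral.integral_congr fun t ht => ?_
          rw [Set.uIcc_of_le Real.pi_pos.le] at ht
          simp only [abs_of_nonneg ht.1]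
        have hneg := intervalIntegral.integral_comp_neg (a := 0) (b := Real.pi)
          fun t : ℝ => δ * (δ + 2 / Real.pi * |t|) ^ (a - 2)
        simp only [abs_neg, neg_zero] at hneg
        rw [← intervalIntegral.integral_add_adjacent_intervals (hi _ 0) (hi 0 _), ← hneg, hpos]
        ring
    _ ≤ δ * (2 * (δ ^ (a - 1) / (2 / Real.pi * (1 - a)))) := by
        gcongr
        exact integral_add_mul_rpow_le ha1 hc hδ Real.pi_pos.le
    _ = _ := by
        rw [Real.rpow_sub_one hδ.ne']
        field_simp

/-! ### Hölder spectra -/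

/-- Letting `x → π` in the Hölder inequality extends it to the missing endpoint, with `f (-π)` as
the value there. -/
theorem HolderSpectrum.norm_sub_le {E : Type*} [NormedAddCommGroup E] {α : ℝ≥0} {f : ℝ → E}
    (hf : HolderSpectrum α f) :
    ∃ C : ℝ, 0 ≤ C ∧
      (∀ x ∈ Set.Ico (-Real.pi) Real.pi, ∀ y ∈ Set.Ico (-Real.pi) Real.pi,
        ‖f x - f y‖ ≤ C * |x - y| ^ (α : ℝ)) ∧
      ∀ y ∈ Set.Ico (-Real.pi) Real.pi, ‖f (-Real.pi) - f y‖ ≤ C * |Real.pi - y| ^ (α : ℝ) := by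
  obtain ⟨⟨C, hC⟩, hlim⟩ := hf
  have h1 : ∀ x ∈ Set.Ico (-Real.pi) Real.pi, ∀ y ∈ Set.Ico (-Real.pi) Real.pi,
      ‖f x - f y‖ ≤ C * |x - y| ^ (α : ℝ) := fun x hx y hy => by
    rw [← dist_eq_norm, ← Real.dist_eq]
    exact hC.dist_le hx hy
  refine ⟨C, C.2, h1, fun y hy => ?_⟩
  have hr : Tendsto (fun x : ℝ => (C : ℝ) * |x - y| ^ (α : ℝ)) (𝓝[<] Real.pi)
      (𝓝 (C * |Real.pi - y| ^ (α : ℝ))) := by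
    refine Tendsto.mono_left (Continuous.tendsto ?_ _) nhdsWithin_le_nhds
    exact continuous_const.mul (Continuous.rpow_const (by fun_prop) fun _ => Or.inr α.2)
  refine le_of_tendsto_of_tendsto (hlim.sub_const (f y)).norm hr ?_
  filter_upwards [Ico_mem_nhdsLT (show -Real.pi < Real.pi by linarith [Real.pi_pos])] with x hx
  exact h1 x hx y hy

theorem HolderSpectrum.holderAlong {E : Type*} [NormedAddCommGroup E] {α : ℝ≥0} {f : ℝ → E}
    (hf : HolderSpectrum α f) :
    HolderAlong circlePt (Set.Ico (-Real.pi) Real.pi) α f := by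
  obtain ⟨C, hC, h1, h2⟩ := hf.norm_sub_le
  have hpi := Real.pi_pos
  have chord : ∀ t : ℝ, |t| ≤ Real.pi → |t| ^ (α : ℝ) ≤
      (Real.pi / 2) ^ (α : ℝ) * ‖circlePt t - 1‖ ^ (α : ℝ) := fun t ht => by
    rw [← Real.mul_rpow (by positivity) (norm_nonneg _)]
    refine Real.rpow_le_rpow (abs_nonneg t) ?_ α.2
    have := abs_le_chord ht
    rw [div_mul_eq_mul_div, div_le_iff₀ hpi] at this
    linarith
  have key : ∀ x ∈ Set.Ico (-Real.pi) Real.pi, ∀ y ∈ Set.Ico (-Real.pi) Real.pi, x ≤ y →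
      ‖f x - f y‖ ≤ 2 * C * (Real.pi / 2) ^ (α : ℝ) * ‖circlePt x - circlePt y‖ ^ (α : ℝ) := by
    intro x hx y hy hxy
    rcases le_total (y - x) Real.pi with hd | hd
    · have h3 := chord (x - y) (by rw [abs_le]; constructor <;> linarith)
      rw [← chord_eq] at h3
      have h4 := (h1 x hx y hy).trans (mul_le_mul_of_nonneg_left h3 hC)
      refine h4.trans ?_
      have : 0 ≤ C * ((Real.pi / 2) ^ (α : ℝ) * ‖circlePt x - circlePt y‖ ^ (α : ℝ)) := by
        positivity
      linarith
    · have hle : -Real.pi ∈ Set.Ico (-Real.pi) Real.pi := ⟨le_rfl, by linarith⟩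
      -- The shorter arc, of length `d`, now passes through `±π`. It splits there into two arcs of
      -- length at most `d`, which accounts for the factor 2.
      set d := x - y + 2 * Real.pi with hdef
      have hd0 : 0 ≤ d := by linarith [hx.1, hy.2]
      have h3 := chord d (by rw [abs_le]; constructor <;> linarith)
      rw [hdef, circlePt_periodic, ← chord_eq, ← hdef] at h3
      have ha : ‖f x - f (-Real.pi)‖ ≤ C * |d| ^ (α : ℝ) := by
        refine (h1 x hx _ hle).trans ?_
        refine mul_le_mul_of_nonneg_left (Real.rpow_le_rpow (abs_nonneg _) ?_ α.2) hC
        rw [abs_of_nonneg (by linarith [hx.1]), abs_of_nonneg hd0]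
        linarith [hy.2]
      have hb : ‖f (-Real.pi) - f y‖ ≤ C * |d| ^ (α : ℝ) := by
        refine (h2 y hy).trans ?_
        refine mul_le_mul_of_nonneg_left (Real.rpow_le_rpow (abs_nonneg _) ?_ α.2) hC
        rw [abs_of_nonneg (by linarith [hy.2]), abs_of_nonneg hd0]
        linarith [hx.1]
      calc ‖f x - f y‖ ≤ ‖f x - f (-Real.pi)‖ + ‖f (-Real.pi) - f y‖ :=
          norm_sub_le_norm_sub_add_norm_sub _ _ _
        _ ≤ 2 * C * |d| ^ (α : ℝ) := by linarith
        _ ≤ 2 * C * ((Real.pi / 2) ^ (α : ℝ) * ‖circlePt x - circlePt y‖ ^ (α : ℝ)) := by gcongr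
        _ = _ := by ring
  refine ⟨2 * C * (Real.pi / 2) ^ (α : ℝ), by positivity, fun x hx y hy => ?_⟩
  rcases le_total x y with h | h
  · exact key x hx y hy h
  · rw [norm_sub_rev, norm_sub_rev (circlePt x)]
    exact key y hy x hx h

/-- The half-open interval is not compact: near `π` the limit `Φ (-π) > 0` gives the bound, and what
remains is compact. -/
theorem HolderSpectrum.exists_pos_le {α : ℝ≥0} {Φ : ℝ → ℝ} (hΦ : HolderSpectrum α Φ) (hα : 0 < α)
    (hpos : ∀ ω ∈ Set.Ico (-Real.pi) Real.pi, 0 < Φ ω) :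
    ∃ m : ℝ, 0 < m ∧ ∀ ω ∈ Set.Ico (-Real.pi) Real.pi, m ≤ Φ ω := by
  obtain ⟨⟨C, hC⟩, hlim⟩ := hΦ
  have hpi := Real.pi_pos
  have hle : -Real.pi ∈ Set.Ico (-Real.pi) Real.pi := ⟨le_rfl, by linarith⟩
  have h0 := hpos _ hle
  have hev := hlim.eventually (lt_mem_nhds (half_lt_self h0))
  obtain ⟨b, hb, hbs⟩ := (mem_nhdsLT_iff_exists_Ioo_subset'
    (show -Real.pi < Real.pi by linarith)).1 hev
  -- Nothing prevents `b < -π`; the maximum keeps the interval nonempty.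
  have hcont : ContinuousOn Φ (Set.Icc (-Real.pi) (max b (-Real.pi))) :=
    (hC.continuousOn hα).mono fun x hx =>
      ⟨hx.1, hx.2.trans_lt (max_lt hb (by linarith))⟩
  obtain ⟨x, hx, hmin⟩ := isCompact_Icc.exists_isMinOn
    (Set.nonempty_Icc.2 (le_max_right b (-Real.pi))) hcont
  have hx' : 0 < Φ x := hpos x ⟨hx.1, hx.2.trans_lt (max_lt hb (by linarith))⟩
  refine ⟨min (Φ x) (Φ (-Real.pi) / 2), lt_min hx' (half_pos h0), fun ω hω => ?_⟩
  rcases le_or_gt ω (max b (-Real.pi)) with h | h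
  · exact (min_le_left _ _).trans (hmin ⟨hω.1, h⟩)
  · exact (min_le_right _ _).trans (le_of_lt (hbs ⟨(le_max_left _ _).trans_lt h, hω.2⟩))

theorem abs_log_sub_log_le {m x y : ℝ} (hm : 0 < m) (hx : m ≤ x) (hy : m ≤ y) :
    |Real.log x - Real.log y| ≤ m⁻¹ * |x - y| := by
  have key : ∀ u v : ℝ, m ≤ u → m ≤ v → Real.log u - Real.log v ≤ m⁻¹ * |u - v| := by
    intro u v hu hv
    have hu' := hm.trans_le hu
    have hv' := hm.trans_le hv
    rw [← Real.log_div hu'.ne' hv'.ne']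
    calc Real.log (u / v) ≤ u / v - 1 := Real.log_le_sub_one_of_pos (div_pos hu' hv')
      _ = v⁻¹ * (u - v) := by field_simp
      _ ≤ v⁻¹ * |u - v| := by gcongr; exact le_abs_self _
      _ ≤ _ := by gcongr
  rw [abs_le']
  exact ⟨key x y hx hy, by rw [neg_sub, abs_sub_comm]; exact key y x hy hx⟩

theorem HolderSpectrum.holderAlong_log {α : ℝ≥0} {Φ : ℝ → ℝ} (hΦ : HolderSpectrum α Φ)
    (hα : 0 < α) (hpos : ∀ ω ∈ Set.Ico (-Real.pi) Real.pi, 0 < Φ ω) :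
    HolderAlong circlePt (Set.Ico (-Real.pi) Real.pi) α (fun ω => (Real.log (Φ ω) : ℂ)) := by
  obtain ⟨m, hm, hmΦ⟩ := hΦ.exists_pos_le hα hpos
  refine (hΦ.holderAlong).lipschitz_comp m⁻¹ (inv_nonneg.2 hm.le) fun x hx y hy => ?_
  rw [← Complex.ofReal_sub, Complex.norm_real, Real.norm_eq_abs, Real.norm_eq_abs]
  exact abs_log_sub_log_le hm (hmΦ x hx) (hmΦ y hy)

/-! ### The growth of the derivative and Hölder continuity in the disk -/

section HardyLittlewood

variable {f : ℂ → ℂ} {a K : ℝ}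

/-- The point `(1 - s) z` has distance at least `s` from the circle, so the derivative along the
radius is dominated by `K s ^ (a - 1)`, integrable at 0 since `a > 0`. -/
theorem norm_sub_radial_le (hf : DifferentiableOn ℂ f (Metric.ball 0 1)) (ha0 : 0 < a)
    (ha1 : a < 1) (hK : 0 ≤ K)
    (hd : ∀ z ∈ Metric.ball (0 : ℂ) 1, ‖deriv f z‖ ≤ K * (1 - ‖z‖) ^ (a - 1))
    {z : ℂ} (hz : z ∈ Metric.ball (0 : ℂ) 1) {h : ℝ} (h0 : 0 ≤ h) (h1 : h ≤ 1) :
    ‖f ((1 - h : ℝ) * z) - f z‖ ≤ K / a * h ^ a := by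
  have hz1 : ‖z‖ < 1 := by simpa using hz
  have hmem : ∀ s ∈ Set.Icc (0 : ℝ) h, ((1 - s : ℝ) : ℂ) * z ∈ Metric.ball (0 : ℂ) 1 := by
    intro s hs
    rw [mem_ball_zero_iff, norm_mul, Complex.norm_real, Real.norm_eq_abs,
      abs_of_nonneg (by linarith [hs.2])]
    nlinarith [norm_nonneg z, hs.1]
  have hder : ∀ s ∈ Set.uIcc (0 : ℝ) h,
      HasDerivAt (fun s : ℝ => f ((1 - s : ℝ) * z)) (deriv f ((1 - s : ℝ) * z) * (-z)) s := by
    intro s hs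
    rw [Set.uIcc_of_le h0] at hs
    have h2 := (hf.differentiableAt (Metric.isOpen_ball.mem_nhds (hmem s hs))).hasDerivAt
    have h3 : HasDerivAt (fun s : ℝ => ((1 - s : ℝ) : ℂ) * z) (-z) s := by
      have h4 := (((hasDerivAt_id s).const_sub 1).ofReal_comp).mul_const z
      simpa using! h4
    exact h2.comp s h3
  have hcont : ContinuousOn (fun s : ℝ => deriv f ((1 - s : ℝ) * z) * (-z)) (Set.uIcc 0 h) := by
    rw [Set.uIcc_of_le h0]
    refine ContinuousOn.mul ?_ continuousOn_const
    exact (hf.deriv Metric.isOpen_ball).continuousOn.comp (by fun_prop) hmem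
  have hint := intervalIntegral.integral_eq_sub_of_hasDerivAt hder hcont.intervalIntegrable
  simp only [sub_zero, Complex.ofReal_one, one_mul] at hint
  rw [← hint]
  calc _ ≤ ∫ s in (0 : ℝ)..h, K * s ^ (a - 1) := by
        refine intervalIntegral.norm_integral_le_of_norm_le h0
          (MeasureTheory.ae_of_all _ fun s hs => ?_)
          ((intervalIntegral.intervalIntegrable_rpow' (by linarith)).const_mul K)
        rw [norm_mul, norm_neg]
        have hs1 : s ≤ 1 - ‖((1 - s : ℝ) : ℂ) * z‖ := by
          rw [norm_mul, Complex.norm_real, Real.norm_eq_abs, abs_of_nonneg (by linarith [hs.2])]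
          nlinarith [norm_nonneg z, hs.1, hs.2]
        calc _ ≤ K * (1 - ‖((1 - s : ℝ) : ℂ) * z‖) ^ (a - 1) * 1 :=
              mul_le_mul (hd _ (hmem s ⟨hs.1.le, hs.2⟩)) hz1.le (norm_nonneg _)
                (mul_nonneg hK (Real.rpow_nonneg (hs.1.le.trans hs1) _))
          _ ≤ _ := by
              rw [mul_one]
              exact mul_le_mul_of_nonneg_left
                (Real.rpow_le_rpow_of_nonpos hs.1 hs1 (by linarith)) hK
    _ = K / a * h ^ a := by
        rw [intervalIntegral.integral_const_mul, integral_rpow (Or.inl (by linarith)),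
          sub_add_cancel, Real.zero_rpow ha0.ne']
        ring

/-- An analytic function whose derivative grows at most like `(1 - |z|) ^ (a - 1)` is Hölder of
order `a` in the disk. -/
theorem holderAlong_of_norm_deriv_le (hf : DifferentiableOn ℂ f (Metric.ball 0 1)) (ha0 : 0 < a)
    (ha1 : a < 1) (hK : 0 ≤ K)
    (hd : ∀ z ∈ Metric.ball (0 : ℂ) 1, ‖deriv f z‖ ≤ K * (1 - ‖z‖) ^ (a - 1)) :
    HolderAlong id (Metric.ball (0 : ℂ) 1) a f := by
  refine ⟨2 * (K / a) + 2 * K, by positivity, fun z hz w hw => ?_⟩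
  rcases eq_or_ne z w with rfl | hzw
  · simp [Real.zero_rpow ha0.ne']
  -- Both points are pulled inwards by the factor `1 - h`, with `h` comparable to their distance;
  -- halving ensures `h < 1`. At that depth the derivative is at most `K h ^ (a - 1)`, and the mean
  -- value inequality costs only `2 K h ^ a`.
  set h := ‖z - w‖ / 2 with hh
  have hpos : 0 < h := half_pos (norm_pos_iff.2 (sub_ne_zero.2 hzw))
  have hz1 : ‖z‖ < 1 := by simpa using hz
  have hw1 : ‖w‖ < 1 := by simpa using hw
  have h1 : h < 1 := by
    have := norm_sub_le z w
    linarith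
  have hmem : ∀ u : ℂ, ‖u‖ < 1 → ((1 - h : ℝ) : ℂ) * u ∈ Metric.closedBall (0 : ℂ) (1 - h) := by
    intro u hu
    rw [mem_closedBall_zero_iff, norm_mul, Complex.norm_real, Real.norm_eq_abs,
      abs_of_nonneg (by linarith)]
    nlinarith [norm_nonneg u]
  have hsub : Metric.closedBall (0 : ℂ) (1 - h) ⊆ Metric.ball 0 1 :=
    Metric.closedBall_subset_ball (by linarith)
  have hmid : ‖f ((1 - h : ℝ) * z) - f ((1 - h : ℝ) * w)‖ ≤
      K * h ^ (a - 1) * ‖((1 - h : ℝ) : ℂ) * z - (1 - h : ℝ) * w‖ := by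
    refine (convex_closedBall (0 : ℂ) (1 - h)).norm_image_sub_le_of_norm_deriv_le
      (fun u hu => hf.differentiableAt (Metric.isOpen_ball.mem_nhds (hsub hu))) (fun u hu => ?_)
      (hmem w hw1) (hmem z hz1)
    refine (hd u (hsub hu)).trans (mul_le_mul_of_nonneg_left ?_ hK)
    rw [mem_closedBall_zero_iff] at hu
    exact Real.rpow_le_rpow_of_nonpos hpos (by linarith) (by linarith)
  have hmid' : ‖f ((1 - h : ℝ) * z) - f ((1 - h : ℝ) * w)‖ ≤ 2 * K * h ^ a := by
    refine hmid.trans ?_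
    rw [← mul_sub, norm_mul, Complex.norm_real, Real.norm_eq_abs, abs_of_nonneg (by linarith),
      show ‖z - w‖ = 2 * h by linarith, Real.rpow_sub_one hpos.ne']
    have h5 : K * (h ^ a / h) * ((1 - h) * (2 * h)) = 2 * K * h ^ a * (1 - h) := by
      field_simp
    rw [h5]
    exact mul_le_of_le_one_right (by positivity) (by linarith)
  have hrz := norm_sub_radial_le hf ha0 ha1 hK hd hz hpos.le h1.le
  have hrw := norm_sub_radial_le hf ha0 ha1 hK hd hw hpos.le h1.le
  have hle : h ^ a ≤ ‖id z - id w‖ ^ a :=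
    Real.rpow_le_rpow hpos.le (by simp only [id]; linarith) ha0.le
  calc ‖f z - f w‖ = ‖-(f ((1 - h : ℝ) * z) - f z) +
        (f ((1 - h : ℝ) * z) - f ((1 - h : ℝ) * w)) + (f ((1 - h : ℝ) * w) - f w)‖ := by
        congr 1; ring
    _ ≤ ‖f ((1 - h : ℝ) * z) - f z‖ + ‖f ((1 - h : ℝ) * z) - f ((1 - h : ℝ) * w)‖ +
        ‖f ((1 - h : ℝ) * w) - f w‖ := by
        refine norm_add₃_le.trans ?_
        rw [norm_neg]
    _ ≤ (2 * (K / a) + 2 * K) * h ^ a := by linarith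
    _ ≤ _ := mul_le_mul_of_nonneg_left hle (by positivity)

end HardyLittlewood

/-! ### Radial boundary values -/

theorem ofReal_mul_circlePt_mem_ball {r : ℝ} (hr : r ∈ Set.Ioo (0 : ℝ) 1) (ω : ℝ) :
    (r : ℂ) * circlePt ω ∈ Metric.ball (0 : ℂ) 1 := by
  rw [mem_ball_zero_iff, norm_mul, norm_circlePt, mul_one, Complex.norm_real, Real.norm_eq_abs,
    abs_of_pos hr.1]
  exact hr.2

theorem HolderAlong.tendsto_limUnder_radial {f : ℂ → ℂ} {a : ℝ} (ha : 0 < a)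
    (hf : HolderAlong id (Metric.ball (0 : ℂ) 1) a f) (ω : ℝ) :
    Tendsto (fun r : ℝ => f (r * circlePt ω)) (𝓝[<] 1)
      (𝓝 (limUnder (𝓝[<] (1 : ℝ)) fun r : ℝ => f (r * circlePt ω))) := by
  obtain ⟨K, hK, hf⟩ := hf
  refine tendsto_nhds_limUnder (cauchy_map_iff_exists_tendsto.1 ?_)
  rw [cauchy_map_iff, tendsto_uniformity_iff_dist_tendsto_zero]
  refine ⟨inferInstance, ?_⟩
  have hlim : Tendsto (fun p : ℝ × ℝ => K * |p.1 - p.2| ^ a) (𝓝[<] 1 ×ˢ 𝓝[<] 1) (𝓝 0) := by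
    have hc : Continuous fun p : ℝ × ℝ => K * |p.1 - p.2| ^ a :=
      continuous_const.mul (Continuous.rpow_const (by fun_prop) fun _ => Or.inr ha.le)
    have := hc.tendsto (1, 1)
    simp only [sub_self, abs_zero, Real.zero_rpow ha.ne', mul_zero, nhds_prod_eq] at this
    exact this.mono_left (Filter.prod_mono nhdsWithin_le_nhds nhdsWithin_le_nhds)
  have hmem : ∀ᶠ r in 𝓝[<] (1 : ℝ), r ∈ Set.Ioo (0 : ℝ) 1 := Ioo_mem_nhdsLT zero_lt_one
  refine squeeze_zero' (Eventually.of_forall fun _ => dist_nonneg) ?_ hlim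
  filter_upwards [hmem.prod_mk hmem] with p hp
  have h := hf _ (ofReal_mul_circlePt_mem_ball hp.1 ω) _ (ofReal_mul_circlePt_mem_ball hp.2 ω)
  rwa [id, id, ← sub_mul, norm_mul, norm_circlePt, mul_one, ← Complex.ofReal_sub,
    Complex.norm_real, Real.norm_eq_abs, ← dist_eq_norm] at h

/-- The Hölder inequality at radius `r` passes to the limit with the same constant, as scaling by `r
< 1` shrinks chords. -/
theorem HolderAlong.limUnder_radial {f : ℂ → ℂ} {a : ℝ} (ha : 0 < a)
    (hf : HolderAlong id (Metric.ball (0 : ℂ) 1) a f) (s : Set ℝ) :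
    HolderAlong circlePt s a
      (fun ω => limUnder (𝓝[<] (1 : ℝ)) fun r : ℝ => f (r * circlePt ω)) := by
  have hlim := hf.tendsto_limUnder_radial ha
  obtain ⟨K, hK, hf⟩ := hf
  refine ⟨K, hK, fun x _ y _ => ?_⟩
  refine le_of_tendsto (((hlim x).sub (hlim y)).norm) ?_
  filter_upwards [Ioo_mem_nhdsLT (zero_lt_one (α := ℝ))] with r hr
  refine (hf _ (ofReal_mul_circlePt_mem_ball hr x) _ (ofReal_mul_circlePt_mem_ball hr y)).trans ?_
  refine mul_le_mul_of_nonneg_left (Real.rpow_le_rpow (norm_nonneg _) ?_ ha.le) hK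
  rw [id, id, ← mul_sub, norm_mul, Complex.norm_real, Real.norm_eq_abs, abs_of_pos hr.1]
  exact mul_le_of_le_one_left (norm_nonneg _) hr.2.le

/-! ### Integrals against kernels concentrated at a point -/

theorem HolderAlong.continuousOn_circle {E : Type*} [NormedAddCommGroup E] {u : ℝ → E} {a : ℝ}
    {s : Set ℝ} (ha : 0 < a) (hu : HolderAlong circlePt s a u) : ContinuousOn u s := by
  obtain ⟨K, hK, hu⟩ := hu
  intro x hx
  have hc : Continuous fun y => K * ‖circlePt y - circlePt x‖ ^ a :=
    continuous_const.mul (Continuous.rpow_const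
      (by have := continuous_circlePt; fun_prop) fun _ => Or.inr ha.le)
  have h0 := hc.tendsto x
  simp only [sub_self, norm_zero, Real.zero_rpow ha.ne', mul_zero] at h0
  refine tendsto_iff_norm_sub_tendsto_zero.2 ?_
  refine squeeze_zero' (Eventually.of_forall fun _ => norm_nonneg _) ?_
    (h0.mono_left nhdsWithin_le_nhds)
  filter_upwards [self_mem_nhdsWithin] with y hy
  exact hu y hy x hx

theorem HolderAlong.intervalIntegrable {u : ℝ → ℂ} {a : ℝ} (ha : 0 < a)
    (hu : HolderAlong circlePt (Set.Ico (-Real.pi) Real.pi) a u) :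
    IntervalIntegrable u MeasureTheory.volume (-Real.pi) Real.pi := by
  obtain ⟨B, -, hB⟩ := hu.exists_bound ha.le fun x _ => (norm_circlePt x).le
  rw [intervalIntegrable_iff_integrableOn_Ico_of_le (by linarith [Real.pi_pos])]
  exact MeasureTheory.IntegrableOn.of_bound measure_Ico_lt_top
    ((hu.continuousOn_circle ha).aestronglyMeasurable measurableSet_Ico) B
    (MeasureTheory.ae_restrict_of_forall_mem measurableSet_Ico hB)

/-- Applied with `δ = 1 - |z|` (Cauchy), `1 - r` (Poisson) and `1 / n` (Fejér). The constant depends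
on `a` alone, so `u` may vary with the point considered. -/
theorem exists_norm_integral_kernel_le {a : ℝ} (ha0 : 0 < a) (ha1 : a < 1) :
    ∃ C : ℝ, 0 ≤ C ∧ ∀ (K : ℝ) (u : ℝ → ℂ), 0 ≤ K →
      (∀ x ∈ Set.Ico (-Real.pi) Real.pi, ∀ y ∈ Set.Ico (-Real.pi) Real.pi,
        ‖u x - u y‖ ≤ K * ‖circlePt x - circlePt y‖ ^ a) →
      ∀ θ ∈ Set.Ico (-Real.pi) Real.pi, ∀ δ : ℝ, 0 < δ → ∀ (B : ℝ) (k : ℝ → ℂ), 0 ≤ B →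
        (∀ τ, ‖k τ‖ ≤ B * (δ / (δ + ‖circlePt τ - circlePt θ‖) ^ 2)) →
        ‖∫ τ in (-Real.pi)..Real.pi, (u τ - u θ) * k τ‖ ≤ C * (K * B) * δ ^ a := by
  obtain ⟨C, hC, h⟩ := exists_integral_chord_le ha0 ha1
  refine ⟨C, hC, fun K u hK hu θ hθ δ hδ B k hB hk => ?_⟩
  have hcl : Continuous fun τ => ‖circlePt τ - circlePt θ‖ := by
    have := continuous_circlePt; fun_prop
  have hci : Continuous fun τ => (K * B) * (‖circlePt τ - circlePt θ‖ ^ a *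
      (δ / (δ + ‖circlePt τ - circlePt θ‖) ^ 2)) := by
    refine continuous_const.mul ((hcl.rpow_const fun _ => Or.inr ha0.le).mul
      (Continuous.div (by fun_prop) (by fun_prop) fun t => ?_))
    positivity
  -- The integral runs over `(-π, π]`, while `u` is not controlled at `π`.
  have hne : ∀ᵐ τ : ℝ, τ ≠ Real.pi := by
    simp [MeasureTheory.ae_iff]
  calc _ ≤ ∫ τ in (-Real.pi)..Real.pi, (K * B) * (‖circlePt τ - circlePt θ‖ ^ a *
      (δ / (δ + ‖circlePt τ - circlePt θ‖) ^ 2)) := by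
        refine intervalIntegral.norm_integral_le_of_norm_le (by linarith [Real.pi_pos]) ?_
          (hci.intervalIntegrable _ _)
        filter_upwards [hne] with τ hτ hmem
        rw [norm_mul]
        calc _ ≤ (K * ‖circlePt τ - circlePt θ‖ ^ a) *
              (B * (δ / (δ + ‖circlePt τ - circlePt θ‖) ^ 2)) :=
              mul_le_mul (hu τ ⟨hmem.1.le, lt_of_le_of_ne hmem.2 hτ⟩ θ hθ) (hk τ)
                (norm_nonneg _) (by positivity)
          _ = _ := by ring
    _ = (K * B) * ∫ τ in (-Real.pi)..Real.pi, ‖circlePt τ - circlePt θ‖ ^ a *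
      (δ / (δ + ‖circlePt τ - circlePt θ‖) ^ 2) := intervalIntegral.integral_const_mul _ _
    _ ≤ (K * B) * (C * δ ^ a) := mul_le_mul_of_nonneg_left (h δ hδ θ) (by positivity)
    _ = _ := by ring

/-! ### The Cauchy transform of a function on the circle -/

theorem one_sub_norm_le (τ : ℝ) (z : ℂ) : 1 - ‖z‖ ≤ ‖circlePt τ - z‖ := by
  rw [← norm_circlePt τ]; exact norm_sub_norm_le _ _

theorem circlePt_sub_ne_zero (τ : ℝ) {z : ℂ} (hz : ‖z‖ < 1) : circlePt τ - z ≠ 0 :=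
  norm_pos_iff.1 ((sub_pos.2 hz).trans_le (one_sub_norm_le τ z))

/-- The radial distance `1 - |z|` is at most `|e^{iτ} - z|`; it is used once directly and once in
the triangle inequality through `z`. -/
theorem add_chord_le {z : ℂ} {θ : ℝ} (hz : ‖z‖ < 1) (h : z = ‖z‖ * circlePt θ) (τ : ℝ) :
    (1 - ‖z‖) + ‖circlePt τ - circlePt θ‖ ≤ 3 * ‖circlePt τ - z‖ := by
  have h1 := one_sub_norm_le τ z
  have h2 : ‖z - circlePt θ‖ = 1 - ‖z‖ := by
    conv_lhs => rw [h]
    rw [← sub_one_mul, norm_mul, norm_circlePt, mul_one, ← Complex.ofReal_one,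
      ← Complex.ofReal_sub, Complex.norm_real, Real.norm_eq_abs, abs_sub_comm,
      abs_of_pos (sub_pos.2 hz)]
  have h3 := norm_sub_le_norm_sub_add_norm_sub (circlePt τ) z (circlePt θ)
  linarith

theorem inv_sq_le {z : ℂ} {θ : ℝ} (hz : ‖z‖ < 1) (h : z = ‖z‖ * circlePt θ) (τ : ℝ) :
    (‖circlePt τ - z‖ ^ 2)⁻¹ ≤ 9 / ((1 - ‖z‖) + ‖circlePt τ - circlePt θ‖) ^ 2 := by
  have h1 := add_chord_le hz h τ
  have h0 : 0 < (1 - ‖z‖) + ‖circlePt τ - circlePt θ‖ := by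
    have := norm_nonneg (circlePt τ - circlePt θ); linarith
  have h2 : 0 < ‖circlePt τ - z‖ := by linarith
  rw [inv_eq_one_div, div_le_div_iff₀ (by positivity) (by positivity)]
  nlinarith

/-- The Cauchy transform of a function on the circle, parametrized by the angle. -/
def cauchyTransform (u : ℝ → ℂ) (z : ℂ) : ℂ :=
  (1 / (2 * (Real.pi : ℂ))) * ∫ τ in (-Real.pi)..Real.pi, u τ * (circlePt τ / (circlePt τ - z))

theorem continuous_cauchyKernel {z : ℂ} (hz : ‖z‖ < 1) :
    Continuous fun τ => circlePt τ / (circlePt τ - z) :=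
  continuous_circlePt.div (continuous_circlePt.sub continuous_const)
    fun τ => circlePt_sub_ne_zero τ hz

theorem continuous_cauchyKernel_sq {z : ℂ} (hz : ‖z‖ < 1) :
    Continuous fun τ => circlePt τ / (circlePt τ - z) ^ 2 :=
  continuous_circlePt.div ((continuous_circlePt.sub continuous_const).pow 2)
    fun τ => pow_ne_zero 2 (circlePt_sub_ne_zero τ hz)

theorem integral_cauchyKernel {z : ℂ} (hz : ‖z‖ < 1) :
    ∫ τ in (-Real.pi)..Real.pi, circlePt τ / (circlePt τ - z) = 2 * Real.pi := by
  have hper : Function.Periodic (fun τ => circlePt τ / (circlePt τ - z)) (2 * Real.pi) :=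
    fun τ => by simp only [circlePt_periodic τ]
  have h := hper.intervalIntegral_add_eq (-Real.pi) 0
  rw [show -Real.pi + 2 * Real.pi = Real.pi by ring, zero_add] at h
  rw [h]
  have hc := circleIntegral.integral_sub_inv_of_mem_ball (c := 0) (w := z) (R := 1)
    (by simpa using hz)
  rw [circleIntegral] at hc
  have he : ∀ τ : ℝ, deriv (circleMap 0 1) τ • (circleMap 0 1 τ - z)⁻¹ =
      Complex.I * (circlePt τ / (circlePt τ - z)) := fun τ => by
    rw [deriv_circleMap, smul_eq_mul, circleMap, circlePt, mul_comm Complex.I (τ : ℂ)]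
    simp only [Complex.ofReal_one, one_mul, zero_add]
    ring
  simp only [he] at hc
  rw [intervalIntegral.integral_const_mul] at hc
  have := mul_left_cancel₀ Complex.I_ne_zero (hc.trans (mul_comm _ _))
  exact this

theorem two_pi_ne_zero : (2 * (Real.pi : ℂ)) ≠ 0 := by
  simp [Real.pi_ne_zero]

/-- Constants are reproduced, so `u θ` can be subtracted before differentiating; this brings the
Hölder condition into the integral for the derivative. -/
theorem cauchyTransform_eq_add {u : ℝ → ℂ}
    (hu : IntervalIntegrable u MeasureTheory.volume (-Real.pi) Real.pi) {z : ℂ} (hz : ‖z‖ < 1)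
    (c : ℂ) : cauchyTransform u z = cauchyTransform (fun τ => u τ - c) z + c := by
  have hk := continuous_cauchyKernel hz
  have h1 : ∫ τ in (-Real.pi)..Real.pi, (u τ - c) * (circlePt τ / (circlePt τ - z)) =
      (∫ τ in (-Real.pi)..Real.pi, u τ * (circlePt τ / (circlePt τ - z))) -
        c * (2 * Real.pi) := by
    simp only [sub_mul]
    rw [intervalIntegral.integral_sub (hu.mul_continuousOn hk.continuousOn)
      ((hk.intervalIntegrable _ _).const_mul _), intervalIntegral.integral_const_mul,
      integral_cauchyKernel hz]
  rw [cauchyTransform, cauchyTransform, h1]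
  have := two_pi_ne_zero
  field_simp
  ring

theorem hasDerivAt_cauchyTransform {u : ℝ → ℂ}
    (hu : IntervalIntegrable u MeasureTheory.volume (-Real.pi) Real.pi) {z : ℂ} (hz : ‖z‖ < 1) :
    HasDerivAt (cauchyTransform u) ((1 / (2 * (Real.pi : ℂ))) *
      ∫ τ in (-Real.pi)..Real.pi, u τ * (circlePt τ / (circlePt τ - z) ^ 2)) z := by
  set ρ := (1 - ‖z‖) / 2 with hρ
  have hρ0 : 0 < ρ := by linarith
  have hb : ∀ w ∈ Metric.ball z ρ, ρ ≤ 1 - ‖w‖ := fun w hw => by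
    rw [mem_ball_iff_norm] at hw
    have := norm_le_norm_add_norm_sub' w z
    linarith
  have hb' : ∀ w ∈ Metric.ball z ρ, ‖w‖ < 1 := fun w hw => by linarith [hb w hw]
  refine HasDerivAt.const_mul _ (intervalIntegral.hasDerivAt_integral_of_dominated_loc_of_deriv_le
    (F := fun z τ => u τ * (circlePt τ / (circlePt τ - z)))
    (F' := fun z τ => u τ * (circlePt τ / (circlePt τ - z) ^ 2))
    (bound := fun τ => ‖u τ‖ * (ρ ^ 2)⁻¹) (Metric.ball_mem_nhds z hρ0) ?_ ?_ ?_ ?_ ?_ ?_).2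
  · filter_upwards [Metric.ball_mem_nhds z hρ0] with w hw
    exact (hu.mul_continuousOn
      (continuous_cauchyKernel (hb' w hw)).continuousOn).def'.aestronglyMeasurable
  · exact hu.mul_continuousOn (continuous_cauchyKernel hz).continuousOn
  · exact (hu.mul_continuousOn
      (continuous_cauchyKernel_sq hz).continuousOn).def'.aestronglyMeasurable
  · refine MeasureTheory.ae_of_all _ fun τ _ w hw => ?_
    rw [norm_mul, norm_div, norm_pow, norm_circlePt, one_div]
    gcongr
    exact (hb w hw).trans (one_sub_norm_le τ w)
  · exact hu.norm.mul_const _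
  · refine MeasureTheory.ae_of_all _ fun τ _ w hw => ?_
    have hne := circlePt_sub_ne_zero τ (hb' w hw)
    have h1 : HasDerivAt (fun w => circlePt τ - w) (-1) w := by
      simpa using (hasDerivAt_id w).const_sub (circlePt τ)
    have h2 := ((h1.inv hne).const_mul (circlePt τ)).const_mul (u τ)
    convert! h2 using 1
    field_simp

theorem differentiableOn_cauchyTransform {u : ℝ → ℂ}
    (hu : IntervalIntegrable u MeasureTheory.volume (-Real.pi) Real.pi) :
    DifferentiableOn ℂ (cauchyTransform u) (Metric.ball 0 1) := fun z hz =>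
  (hasDerivAt_cauchyTransform hu
    (by simpa using hz)).differentiableAt.differentiableWithinAt

/-- The Cauchy transform preserves Hölder classes. -/
theorem HolderAlong.cauchyTransform {u : ℝ → ℂ} {a : ℝ} (ha0 : 0 < a) (ha1 : a < 1)
    (hu : HolderAlong circlePt (Set.Ico (-Real.pi) Real.pi) a u) :
    HolderAlong id (Metric.ball (0 : ℂ) 1) a (cauchyTransform u) := by
  have hint := hu.intervalIntegrable ha0
  obtain ⟨C, hC, h⟩ := exists_norm_integral_kernel_le ha0 ha1
  obtain ⟨K, hK, hu⟩ := hu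
  refine holderAlong_of_norm_deriv_le (differentiableOn_cauchyTransform hint) ha0 ha1
    (K := (2 * Real.pi)⁻¹ * (C * (K * 9))) (by positivity) fun z hz => ?_
  have hz1 : ‖z‖ < 1 := by simpa using hz
  have hδ : 0 < 1 - ‖z‖ := sub_pos.2 hz1
  obtain ⟨θ, hθ, hzθ⟩ := exists_eq_norm_mul_circlePt z
  have hv : IntervalIntegrable (fun τ => u τ - u θ) MeasureTheory.volume (-Real.pi) Real.pi :=
    hint.sub intervalIntegrable_const
  have heq : WienerFIR.cauchyTransform u =ᶠ[𝓝 z]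
      fun w => WienerFIR.cauchyTransform (fun τ => u τ - u θ) w + u θ := by
    filter_upwards [Metric.isOpen_ball.mem_nhds hz] with w hw
    exact cauchyTransform_eq_add hint (by simpa using hw) _
  rw [heq.deriv_eq, ((hasDerivAt_cauchyTransform hv hz1).add_const _).deriv, norm_mul]
  -- The differentiated kernel lacks the factor `δ` in the numerator; putting `1 / δ` into `B` turns
  -- the bound `δ ^ a` into `δ ^ (a - 1)`.
  have h1 := h K u hK hu θ hθ (1 - ‖z‖) hδ (9 / (1 - ‖z‖))
    (fun τ => circlePt τ / (circlePt τ - z) ^ 2) (by positivity) fun τ => by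
      rw [norm_div, norm_pow, norm_circlePt, one_div]
      refine (inv_sq_le hz1 hzθ τ).trans (le_of_eq ?_)
      field_simp
  have h2 : ‖1 / (2 * (Real.pi : ℂ))‖ = (2 * Real.pi)⁻¹ := by
    rw [norm_div, norm_mul, Complex.norm_real, Real.norm_eq_abs, abs_of_pos Real.pi_pos]
    simp
  rw [h2, mul_assoc]
  refine mul_le_mul_of_nonneg_left (h1.trans (le_of_eq ?_)) (by positivity)
  rw [Real.rpow_sub_one hδ.ne']
  field_simp

/-- The Cauchy transform is the positive part of the Fourier series. -/
theorem positivePart_eq_cauchyTransform {u : ℝ → ℂ}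
    (hu : IntervalIntegrable u MeasureTheory.volume (-Real.pi) Real.pi) {z : ℂ} (hz : ‖z‖ < 1) :
    positivePart u z = cauchyTransform u z := by
  have hq : ∀ τ, ‖z / circlePt τ‖ < 1 := fun τ => by rwa [norm_div, norm_circlePt, div_one]
  -- The Cauchy kernel is the geometric series in `z / e^{iτ}`, integrated term by term.
  have hs : HasSum (fun k : ℕ => ∫ τ in (-Real.pi)..Real.pi, u τ * (z / circlePt τ) ^ k)
      (∫ τ in (-Real.pi)..Real.pi, u τ * (circlePt τ / (circlePt τ - z))) := by
    refine intervalIntegral.hasSum_integral_of_dominated_convergence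
      (fun k τ => ‖u τ‖ * ‖z‖ ^ k) ?_ ?_ ?_ ?_ ?_
    · intro k
      have hc : Continuous fun τ => (z / circlePt τ) ^ k :=
        (continuous_const.div continuous_circlePt circlePt_ne_zero).pow k
      exact (hu.mul_continuousOn hc.continuousOn).def'.aestronglyMeasurable
    · refine fun k => MeasureTheory.ae_of_all _ fun τ _ => ?_
      rw [norm_mul, norm_pow, norm_div, norm_circlePt, div_one]
    · exact MeasureTheory.ae_of_all _ fun τ _ =>
        (summable_geometric_of_lt_one (norm_nonneg z) hz).mul_left _
    · simp only [tsum_mul_left]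
      exact hu.norm.mul_const _
    · refine MeasureTheory.ae_of_all _ fun τ _ => ?_
      have h1 := (hasSum_geometric_of_norm_lt_one (hq τ)).mul_left (u τ)
      rwa [one_sub_div (circlePt_ne_zero τ), inv_div] at h1
  rw [positivePart, cauchyTransform, ← (hs.mul_left _).tsum_eq]
  refine tsum_congr fun k => ?_
  rw [fourierCoeffOn_eq_integral, Complex.real_smul, mul_assoc,
    ← intervalIntegral.integral_mul_const]
  congr 1
  · push_cast; ring
  · refine intervalIntegral.integral_congr fun τ _ => ?_
    have hf : (fourier (-(k : ℤ)) (τ : AddCircle (Real.pi - -Real.pi)) : ℂ) =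
        (circlePt τ ^ k)⁻¹ := by
      rw [fourier_coe_apply, circlePt, ← Complex.exp_nat_mul, ← Complex.exp_neg]
      congr 1
      have : (Real.pi : ℂ) ≠ 0 := by simp [Real.pi_ne_zero]
      push_cast
      field_simp
      ring
    simp only [hf, smul_eq_mul, div_pow]
    ring

/-! ### The Poisson integral of the logarithm -/

/-- The Herglotz kernel `(e^{iτ} + z) / (e^{iτ} - z)` is twice the Cauchy kernel minus 1. -/
theorem outerExponent_eq_cauchyTransform {Φ : ℝ → ℝ}
    (hu : IntervalIntegrable (fun ω => (Real.log (Φ ω) : ℂ)) MeasureTheory.volume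
      (-Real.pi) Real.pi) {z : ℂ} (hz : ‖z‖ < 1) :
    outerExponent Φ z = 2 * cauchyTransform (fun ω => (Real.log (Φ ω) : ℂ)) z +
      -((1 / (2 * (Real.pi : ℂ))) * ∫ τ in (-Real.pi)..Real.pi, (Real.log (Φ τ) : ℂ)) := by
  have h : ∫ τ in (-Real.pi)..Real.pi,
      (Real.log (Φ τ) : ℂ) * ((circlePt τ + z) / (circlePt τ - z)) =
      2 * (∫ τ in (-Real.pi)..Real.pi,
        (Real.log (Φ τ) : ℂ) * (circlePt τ / (circlePt τ - z))) -
      ∫ τ in (-Real.pi)..Real.pi, (Real.log (Φ τ) : ℂ) := by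
    rw [← intervalIntegral.integral_const_mul, ← intervalIntegral.integral_sub
      ((hu.mul_continuousOn (continuous_cauchyKernel hz).continuousOn).const_mul 2) hu]
    refine intervalIntegral.integral_congr fun τ _ => ?_
    have := circlePt_sub_ne_zero τ hz
    field_simp
    ring
  rw [outerExponent, cauchyTransform, h]
  ring

theorem re_div_eq (τ : ℝ) (z : ℂ) :
    ((circlePt τ + z) / (circlePt τ - z)).re = (1 - ‖z‖ ^ 2) / ‖circlePt τ - z‖ ^ 2 := by
  have h1 : (circlePt τ).re ^ 2 + (circlePt τ).im ^ 2 = 1 := by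
    have := Complex.sq_norm_sub_sq_re (circlePt τ)
    rw [norm_circlePt] at this
    linarith
  have h2 : ‖z‖ ^ 2 = z.re ^ 2 + z.im ^ 2 := by
    have := Complex.sq_norm_sub_sq_re z
    linarith
  rw [Complex.div_re, ← add_div, h2, Complex.normSq_eq_norm_sq]
  congr 1
  simp only [Complex.add_re, Complex.sub_re, Complex.add_im, Complex.sub_im]
  linear_combination h1

/-- The real part is the Poisson integral of `log Φ`, and the Poisson kernel is an approximate
identity. This fixes the modulus of the boundary value of `Φ₊`. -/
theorem tendsto_re_outerExponent {Φ : ℝ → ℝ} {a : ℝ} (ha0 : 0 < a) (ha1 : a < 1)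
    (hu : HolderAlong circlePt (Set.Ico (-Real.pi) Real.pi) a
      (fun ω => (Real.log (Φ ω) : ℂ))) {θ : ℝ} (hθ : θ ∈ Set.Ico (-Real.pi) Real.pi) :
    Tendsto (fun r : ℝ => (outerExponent Φ (r * circlePt θ)).re) (𝓝[<] 1)
      (𝓝 (Real.log (Φ θ))) := by
  have hint := hu.intervalIntegrable ha0
  obtain ⟨C, hC, h⟩ := exists_norm_integral_kernel_le ha0 ha1
  obtain ⟨K, hK, hu⟩ := hu
  have key : ∀ r ∈ Set.Ioo (0 : ℝ) 1,
      ‖(outerExponent Φ (r * circlePt θ)).re - Real.log (Φ θ)‖ ≤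
        (2 * Real.pi)⁻¹ * (C * (K * 18) * (1 - r) ^ a) := by
    intro r hr
    set z : ℂ := r * circlePt θ with hzdef
    have hzn : ‖z‖ = r := by
      rw [hzdef, norm_mul, norm_circlePt, mul_one, Complex.norm_real, Real.norm_eq_abs,
        abs_of_pos hr.1]
    have hz : ‖z‖ < 1 := hzn ▸ hr.2
    have hk : Continuous fun τ => (circlePt τ + z) / (circlePt τ - z) :=
      (continuous_circlePt.add continuous_const).div (continuous_circlePt.sub continuous_const)
        fun τ => circlePt_sub_ne_zero τ hz
    have hone : ∫ τ in (-Real.pi)..Real.pi, (circlePt τ + z) / (circlePt τ - z) =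
        2 * Real.pi := by
      have h3 : ∀ τ, (circlePt τ + z) / (circlePt τ - z) =
          2 * (circlePt τ / (circlePt τ - z)) - 1 := fun τ => by
        have := circlePt_sub_ne_zero τ hz
        field_simp
        ring
      simp only [h3]
      rw [intervalIntegral.integral_sub
        (((continuous_cauchyKernel hz).intervalIntegrable _ _).const_mul 2)
        intervalIntegrable_const, intervalIntegral.integral_const_mul,
        integral_cauchyKernel hz, intervalIntegral.integral_const, Complex.real_smul]
      push_cast
      ring
    have hsub : outerExponent Φ z - (Real.log (Φ θ) : ℂ) = (1 / (2 * (Real.pi : ℂ))) *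
        ∫ τ in (-Real.pi)..Real.pi, ((Real.log (Φ τ) : ℂ) - (Real.log (Φ θ) : ℂ)) *
          ((circlePt τ + z) / (circlePt τ - z)) := by
      simp only [sub_mul]
      rw [intervalIntegral.integral_sub (hint.mul_continuousOn hk.continuousOn)
        ((hk.intervalIntegrable _ _).const_mul _), intervalIntegral.integral_const_mul,
        hone, outerExponent]
      have := two_pi_ne_zero
      field_simp
    have hre : (((outerExponent Φ z).re - Real.log (Φ θ) : ℝ) : ℂ) = (1 / (2 * (Real.pi : ℂ))) *
        ∫ τ in (-Real.pi)..Real.pi, ((Real.log (Φ τ) : ℂ) - (Real.log (Φ θ) : ℂ)) *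
          (((circlePt τ + z) / (circlePt τ - z)).re : ℂ) := by
      have hi : IntervalIntegrable (fun τ => ((Real.log (Φ τ) : ℂ) - (Real.log (Φ θ) : ℂ)) *
          ((circlePt τ + z) / (circlePt τ - z))) MeasureTheory.volume (-Real.pi) Real.pi :=
        (hint.sub intervalIntegrable_const).mul_continuousOn hk.continuousOn
      have h4 := Complex.reCLM.intervalIntegral_comp_comm hi
      simp only [Complex.reCLM_apply] at h4
      have h5 : (outerExponent Φ z).re - Real.log (Φ θ) =
          (outerExponent Φ z - (Real.log (Φ θ) : ℂ)).re := by
        rw [Complex.sub_re, Complex.ofReal_re]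
      rw [h5, hsub,
        show (1 / (2 * (Real.pi : ℂ))) = ((1 / (2 * Real.pi) : ℝ) : ℂ) by push_cast; rfl,
        Complex.re_ofReal_mul, ← h4, Complex.ofReal_mul, ← intervalIntegral.integral_ofReal]
      congr 1
      refine intervalIntegral.integral_congr fun τ _ => ?_
      simp only [← Complex.ofReal_sub, Complex.re_ofReal_mul, Complex.ofReal_mul]
    rw [← Complex.norm_real, hre, norm_mul]
    have h2 : ‖1 / (2 * (Real.pi : ℂ))‖ = (2 * Real.pi)⁻¹ := by
      rw [norm_div, norm_mul, Complex.norm_real, Real.norm_eq_abs, abs_of_pos Real.pi_pos]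
      simp
    rw [h2]
    refine mul_le_mul_of_nonneg_left ?_ (by positivity)
    -- `18 = 2 * 9`, from `1 - r ^ 2 ≤ 2 (1 - r)` and `inv_sq_le`.
    refine h K _ hK hu θ hθ (1 - r) (by linarith [hr.2]) 18 _ (by norm_num) fun τ => ?_
    have h6 := inv_sq_le hz (by rw [hzn]) τ
    rw [Complex.norm_real, re_div_eq, Real.norm_eq_abs, hzn, abs_of_nonneg
      (div_nonneg (by nlinarith [hr.1, hr.2]) (by positivity)), div_eq_mul_inv]
    rw [hzn] at h6
    have hr1 : 0 < 1 - r := by linarith [hr.2]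
    calc (1 - r ^ 2) * (‖circlePt τ - z‖ ^ 2)⁻¹ ≤ (2 * (1 - r)) * (‖circlePt τ - z‖ ^ 2)⁻¹ := by
          refine mul_le_mul_of_nonneg_right ?_ (by positivity)
          nlinarith
      _ ≤ (2 * (1 - r)) * (9 / ((1 - r) + ‖circlePt τ - circlePt θ‖) ^ 2) :=
          mul_le_mul_of_nonneg_left h6 (by linarith)
      _ = _ := by ring
  refine tendsto_iff_norm_sub_tendsto_zero.2 ?_
  have hlim : Tendsto (fun r : ℝ => (2 * Real.pi)⁻¹ * (C * (K * 18) * (1 - r) ^ a)) (𝓝[<] 1)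
      (𝓝 0) := by
    have hc : Continuous fun r : ℝ => (2 * Real.pi)⁻¹ * (C * (K * 18) * (1 - r) ^ a) :=
      continuous_const.mul (continuous_const.mul
        (Continuous.rpow_const (by fun_prop) fun _ => Or.inr ha0.le))
    have := hc.tendsto 1
    simp only [sub_self, Real.zero_rpow ha0.ne', mul_zero] at this
    exact this.mono_left nhdsWithin_le_nhds
  refine squeeze_zero' (Eventually.of_forall fun _ => norm_nonneg _) ?_ hlim
  filter_upwards [Ioo_mem_nhdsLT (zero_lt_one (α := ℝ))] with r hr
  exact key r hr

/-! ### Fejér means -/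

theorem integral_circlePt_pow_mul_inv (k l : ℕ) :
    ∫ t in (-Real.pi)..Real.pi, circlePt t ^ k * (circlePt t ^ l)⁻¹ =
      if k = l then 2 * (Real.pi : ℂ) else 0 := by
  split_ifs with h
  · subst h
    have : ∀ t, circlePt t ^ k * (circlePt t ^ k)⁻¹ = 1 := fun t =>
      mul_inv_cancel₀ (pow_ne_zero k (circlePt_ne_zero t))
    simp only [this, intervalIntegral.integral_const, Complex.real_smul]
    push_cast
    ring
  · have hc : ((k : ℂ) - l) * Complex.I ≠ 0 :=
      mul_ne_zero (sub_ne_zero.2 (by exact_mod_cast h)) Complex.I_ne_zero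
    have he : ∀ t, circlePt t ^ k * (circlePt t ^ l)⁻¹ =
        Complex.exp (((k : ℂ) - l) * Complex.I * t) := fun t => by
      rw [circlePt, ← Complex.exp_nat_mul, ← Complex.exp_nat_mul, ← Complex.exp_neg,
        ← Complex.exp_add]
      congr 1
      ring
    simp only [he]
    rw [integral_exp_mul_complex hc, div_eq_zero_iff, sub_eq_zero]
    left
    have hper := Complex.exp_periodic.int_mul ((k : ℤ) - l)
      (((k : ℂ) - l) * Complex.I * ((-Real.pi : ℝ) : ℂ))
    rw [← hper]
    congr 1
    push_cast
    ring

/-- The Dirichlet-type sum whose squared modulus is a multiple of the Fejér kernel. -/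
def geomSum (n : ℕ) (t : ℝ) : ℂ := ∑ j ∈ Finset.range n, circlePt t ^ j

theorem continuous_geomSum (n : ℕ) : Continuous (geomSum n) :=
  continuous_finsetSum _ fun j _ => continuous_circlePt.pow j

theorem norm_geomSum_le (n : ℕ) (t : ℝ) : ‖geomSum n t‖ ≤ n := by
  refine (norm_sum_le _ _).trans (le_of_eq ?_)
  simp [norm_circlePt]

theorem norm_geomSum_mul_chord_le (n : ℕ) (t : ℝ) :
    ‖geomSum n t‖ * ‖circlePt t - 1‖ ≤ 2 := by
  rw [← norm_mul, geomSum, geom_sum_mul]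
  refine (norm_sub_le _ _).trans ?_
  rw [norm_pow, norm_circlePt, one_pow, norm_one]
  norm_num

/-- Truncated subtraction matters: the count is 0 for `k ≥ n`, which later cuts the power series
down to a polynomial. -/
theorem sum_ite_add_eq (n k : ℕ) (c : ℂ) :
    ∑ j ∈ Finset.range n, ∑ l ∈ Finset.range n, (if k + j = l then c else 0) =
      ((n - k : ℕ) : ℂ) * c := by
  have h1 : (Finset.range n).filter (fun j => k + j < n) = Finset.range (n - k) := by
    ext j
    simp only [Finset.mem_filter, Finset.mem_range]
    omega
  simp only [Finset.sum_ite_eq, Finset.mem_range]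
  rw [← Finset.sum_filter, h1, Finset.sum_const, Finset.card_range, nsmul_eq_mul]

theorem integral_pow_mul_geomSum (n k : ℕ) :
    ∫ t in (-Real.pi)..Real.pi, circlePt t ^ k * (geomSum n t * conj (geomSum n t)) =
      ((n - k : ℕ) : ℂ) * (2 * Real.pi) := by
  have he : ∀ t, circlePt t ^ k * (geomSum n t * conj (geomSum n t)) =
      ∑ j ∈ Finset.range n, ∑ l ∈ Finset.range n,
        circlePt t ^ (k + j) * (circlePt t ^ l)⁻¹ := fun t => by
    rw [geomSum, map_sum, Finset.sum_mul_sum, Finset.mul_sum]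
    refine Finset.sum_congr rfl fun j _ => ?_
    rw [Finset.mul_sum]
    refine Finset.sum_congr rfl fun l _ => ?_
    rw [map_pow, conj_circlePt, inv_pow, pow_add, mul_assoc]
  have hc : ∀ j l : ℕ, Continuous fun t => circlePt t ^ (k + j) * (circlePt t ^ l)⁻¹ :=
    fun j l => (continuous_circlePt.pow _).mul ((continuous_circlePt.pow _).inv₀ fun t =>
      pow_ne_zero l (circlePt_ne_zero t))
  simp only [he]
  rw [intervalIntegral.integral_finsetSum fun j _ =>
    (continuous_finsetSum _ fun l _ => hc j l).intervalIntegrable _ _]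
  rw [← sum_ite_add_eq n k]
  refine Finset.sum_congr rfl fun j _ => ?_
  rw [intervalIntegral.integral_finsetSum fun l _ => (hc j l).intervalIntegrable _ _]
  exact Finset.sum_congr rfl fun l _ => integral_circlePt_pow_mul_inv _ _

theorem norm_mul_circlePt (z : ℂ) (t : ℝ) : ‖z * circlePt t‖ = ‖z‖ := by
  rw [norm_mul, norm_circlePt, mul_one]

theorem hasSum_powerCoeff {H : ℂ → ℂ} (hH : DifferentiableOn ℂ H (Metric.ball 0 1)) {z : ℂ}
    (hz : ‖z‖ < 1) : HasSum (fun k : ℕ => powerCoeff H k * z ^ k) (H z) := by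
  have h := Complex.hasSum_taylorSeries_on_ball hH (z := z) (by simpa using hz)
  refine h.congr_fun fun k => ?_
  simp only [powerCoeff, smul_eq_mul, sub_zero]
  ring

theorem integral_mul_geomSum {H : ℂ → ℂ} (hH : DifferentiableOn ℂ H (Metric.ball 0 1)) {z : ℂ}
    (hz : ‖z‖ < 1) (n : ℕ) :
    ∫ t in (-Real.pi)..Real.pi, H (z * circlePt t) * (geomSum n t * conj (geomSum n t)) =
      ∑ k ∈ Finset.range n, powerCoeff H k * z ^ k * (((n - k : ℕ) : ℂ) * (2 * Real.pi)) := by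
  have hcont : Continuous fun t => geomSum n t * conj (geomSum n t) :=
    (continuous_geomSum n).mul (Complex.continuous_conj.comp (continuous_geomSum n))
  have hsum : Summable fun k : ℕ => ‖powerCoeff H k * z ^ k‖ :=
    (hasSum_powerCoeff hH hz).summable.norm
  have hs : HasSum (fun k : ℕ => ∫ t in (-Real.pi)..Real.pi, powerCoeff H k * z ^ k *
      (circlePt t ^ k * (geomSum n t * conj (geomSum n t))))
      (∫ t in (-Real.pi)..Real.pi, H (z * circlePt t) *
        (geomSum n t * conj (geomSum n t))) := by
    refine intervalIntegral.hasSum_integral_of_dominated_convergence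
      (fun k _ => ‖powerCoeff H k * z ^ k‖ * (n * n)) ?_ ?_ ?_ ?_ ?_
    · exact fun k => (continuous_const.mul
        ((continuous_circlePt.pow k).mul hcont)).aestronglyMeasurable
    · refine fun k => MeasureTheory.ae_of_all _ fun t _ => ?_
      rw [norm_mul]
      refine mul_le_mul_of_nonneg_left ?_ (norm_nonneg _)
      rw [norm_mul, norm_mul, norm_pow, norm_circlePt, one_pow, one_mul, RCLike.norm_conj]
      have := norm_geomSum_le n t
      gcongr
    · exact MeasureTheory.ae_of_all _ fun t _ => hsum.mul_right _
    · exact intervalIntegrable_const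
    · refine MeasureTheory.ae_of_all _ fun t _ => ?_
      have h := (hasSum_powerCoeff hH (z := z * circlePt t) (by rwa [norm_mul_circlePt])).mul_right
        (geomSum n t * conj (geomSum n t))
      refine h.congr_fun fun k => ?_
      rw [mul_pow]
      ring
  rw [← hs.tsum_eq]
  simp only [intervalIntegral.integral_const_mul, integral_pow_mul_geomSum]
  refine tsum_eq_sum fun k hk => ?_
  rw [Finset.mem_range, not_lt] at hk
  rw [Nat.sub_eq_zero_of_le hk]
  simp

theorem eval_fejerMean (H : ℂ → ℂ) {n : ℕ} (hn : 1 ≤ n) (z : ℂ) :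
    (fejerMean H (n - 1)).eval z =
      ∑ k ∈ Finset.range n, (1 - (k : ℂ) / n) * powerCoeff H k * z ^ k := by
  rw [fejerMean, Polynomial.eval_finsetSum, Nat.sub_add_cancel hn, Nat.cast_sub hn]
  simp

theorem natDegree_fejerMean_le (H : ℂ → ℂ) (N : ℕ) : (fejerMean H N).natDegree ≤ N := by
  refine Polynomial.natDegree_sum_le_of_forall_le _ _ fun k hk => ?_
  exact (Polynomial.natDegree_C_mul_X_pow_le _ _).trans (Nat.lt_succ_iff.1 (Finset.mem_range.1 hk))

/-- The Fejér mean as a convolution with the Fejér kernel. -/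
theorem eval_fejerMean_sub {H : ℂ → ℂ} (hH : DifferentiableOn ℂ H (Metric.ball 0 1)) {z : ℂ}
    (hz : ‖z‖ < 1) {n : ℕ} (hn : 1 ≤ n) :
    (fejerMean H (n - 1)).eval z - H z = (2 * (Real.pi : ℂ))⁻¹ *
      ∫ t in (-Real.pi)..Real.pi, (H (z * circlePt t) - H (z * circlePt 0)) *
        (geomSum n t * conj (geomSum n t) / n) := by
  have hn0 : (n : ℂ) ≠ 0 := by exact_mod_cast (Nat.one_le_iff_ne_zero.1 hn)
  have hcont : Continuous fun t => geomSum n t * conj (geomSum n t) :=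
    (continuous_geomSum n).mul (Complex.continuous_conj.comp (continuous_geomSum n))
  have hHc : Continuous fun t => H (z * circlePt t) :=
    hH.continuousOn.comp_continuous (continuous_const.mul continuous_circlePt) fun t => by
      rwa [mem_ball_zero_iff, norm_mul_circlePt]
  have h0 : circlePt 0 = 1 := by simp [circlePt]
  have hone := integral_pow_mul_geomSum n 0
  simp only [pow_zero, one_mul, Nat.sub_zero] at hone
  simp only [mul_div_assoc', intervalIntegral.integral_div, sub_mul, h0, mul_one]
  have hi : IntervalIntegrable (fun t => H (z * circlePt t) *
      (geomSum n t * conj (geomSum n t))) MeasureTheory.volume (-Real.pi) Real.pi :=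
    (hHc.mul hcont).intervalIntegrable _ _
  rw [intervalIntegral.integral_sub hi
    ((hcont.intervalIntegrable _ _).const_mul _), intervalIntegral.integral_const_mul, hone,
    integral_mul_geomSum hH hz, eval_fejerMean H hn]
  have hpi := two_pi_ne_zero
  have hsum : ∑ k ∈ Finset.range n, powerCoeff H k * z ^ k * (((n - k : ℕ) : ℂ) * (2 * Real.pi)) =
      (2 * Real.pi) * n * ∑ k ∈ Finset.range n, (1 - (k : ℂ) / n) * powerCoeff H k * z ^ k := by
    rw [Finset.mul_sum]
    refine Finset.sum_congr rfl fun k hk => ?_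
    rw [Nat.cast_sub (Finset.mem_range.1 hk).le]
    field_simp
  rw [hsum]
  field_simp

/-- A Hölder analytic function of order less than one is approximated by its Fejér means. -/
theorem exists_norm_sub_fejerMean_le {H : ℂ → ℂ} {a : ℝ} (ha0 : 0 < a) (ha1 : a < 1)
    (hH : DifferentiableOn ℂ H (Metric.ball 0 1))
    (hHol : HolderAlong id (Metric.ball (0 : ℂ) 1) a H) :
    ∃ C : ℝ, 0 ≤ C ∧ ∀ n : ℕ, 1 ≤ n → ∀ z : ℂ, ‖z‖ < 1 →
      ‖H z - (fejerMean H (n - 1)).eval z‖ ≤ C * (n : ℝ) ^ (-a) := by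
  obtain ⟨C, hC, h⟩ := exists_norm_integral_kernel_le ha0 ha1
  obtain ⟨K, hK, hHol⟩ := hHol
  refine ⟨(2 * Real.pi)⁻¹ * (C * (K * 9)), by positivity, fun n hn z hz => ?_⟩
  have hn0 : (0 : ℝ) < n := by exact_mod_cast hn
  have hmem : ∀ t, z * circlePt t ∈ Metric.ball (0 : ℂ) 1 := fun t => by
    rwa [mem_ball_zero_iff, norm_mul_circlePt]
  have h0 : circlePt 0 = 1 := by simp [circlePt]
  rw [norm_sub_rev, eval_fejerMean_sub hH hz hn, norm_mul, norm_inv, norm_mul, Complex.norm_real,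
    Real.norm_eq_abs, abs_of_pos Real.pi_pos, Complex.norm_ofNat, mul_assoc]
  refine mul_le_mul_of_nonneg_left ?_ (by positivity)
  -- The kernel estimate is applied along the circle through `z`, with `z` itself at angle 0.
  have hmain := h K (fun t => H (z * circlePt t)) hK (fun x _ y _ => ?_) 0
    ⟨by linarith [Real.pi_pos], Real.pi_pos⟩ (1 / n) (by positivity) 9
    (fun t => geomSum n t * conj (geomSum n t) / n) (by norm_num) fun t => ?_
  · refine hmain.trans (le_of_eq ?_)
    rw [one_div, Real.inv_rpow hn0.le, Real.rpow_neg hn0.le]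
  · refine (hHol _ (hmem x) _ (hmem y)).trans ?_
    refine mul_le_mul_of_nonneg_left (Real.rpow_le_rpow (norm_nonneg _) ?_ ha0.le) hK
    rw [id, id, ← mul_sub, norm_mul]
    exact mul_le_of_le_one_left (norm_nonneg _) hz.le
  · rw [h0, norm_div, norm_mul, RCLike.norm_conj, Complex.norm_natCast]
    have h1 := norm_geomSum_le n t
    have h2 := norm_geomSum_mul_chord_le n t
    -- The trivial bound `n` contributes 1 and the closed form of the geometric sum contributes 2;
    -- squaring gives the 9.
    have h3 : ‖geomSum n t‖ * (1 / n + ‖circlePt t - 1‖) ≤ 3 := by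
      have : ‖geomSum n t‖ * (1 / n) ≤ 1 := by
        rw [mul_one_div, div_le_one hn0]; exact h1
      linarith
    have hpos : (0 : ℝ) < 1 / n + ‖circlePt t - 1‖ := by positivity
    have h4 : (‖geomSum n t‖ * (1 / n + ‖circlePt t - 1‖)) ^ 2 ≤ 3 ^ 2 :=
      pow_le_pow_left₀ (by positivity) h3 2
    rw [mul_div_assoc', le_div_iff₀ (by positivity), div_mul_eq_mul_div, div_le_iff₀ hn0]
    calc _ = (‖geomSum n t‖ * (1 / n + ‖circlePt t - 1‖)) ^ 2 := by ring
      _ ≤ 3 ^ 2 := h4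
      _ = 9 * (1 / n) * n := by field_simp; norm_num

theorem diskNorm_le {f : ℂ → ℂ} {B : ℝ} (h : ∀ z : ℂ, ‖z‖ < 1 → ‖f z‖ ≤ B) :
    diskNorm f ≤ ENNReal.ofReal B :=
  iSup₂_le fun z hz => by
    rw [← ofReal_norm]
    exact ENNReal.ofReal_le_ofReal (h z (by simpa using hz))

/-- FIR approximation of analytic functions that are Hölder in the disk. -/
theorem exists_fir_approximation {H : ℂ → ℂ} {a : ℝ} (ha0 : 0 < a) (ha1 : a < 1)
    (hH : DifferentiableOn ℂ H (Metric.ball 0 1))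
    (hHol : HolderAlong id (Metric.ball (0 : ℂ) 1) a H) :
    ∃ C : ℝ, ∀ N : ℕ, 1 ≤ N →
      (∃ P : ℂ[X], P.natDegree ≤ N ∧
        diskNorm (fun z => H z - P.eval z) ≤ ENNReal.ofReal (C * (N : ℝ) ^ (-a))) ∧
      diskNorm (fun z => H z - (valleePoussinMean H N).eval z) ≤
        ENNReal.ofReal (C * (N : ℝ) ^ (-a)) := by
  obtain ⟨C, hC, h⟩ := exists_norm_sub_fejerMean_le ha0 ha1 hH hHol
  -- `3 = 2 + 1`, from the coefficients of the two Fejér means. The Fejér mean of index `N` already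
  -- serves as the FIR filter.
  refine ⟨3 * C, fun N hN => ?_⟩
  have hN0 : (0 : ℝ) < N := by exact_mod_cast hN
  have hmono : ∀ n : ℕ, N ≤ n → ∀ z : ℂ, ‖z‖ < 1 →
      ‖H z - (fejerMean H (n - 1)).eval z‖ ≤ C * (N : ℝ) ^ (-a) := fun n hn z hz => by
    refine (h n (hN.trans hn) z hz).trans (mul_le_mul_of_nonneg_left ?_ hC)
    exact Real.rpow_le_rpow_of_nonpos hN0 (by exact_mod_cast hn) (by linarith)
  have hnn : 0 ≤ C * (N : ℝ) ^ (-a) := mul_nonneg hC (Real.rpow_nonneg hN0.le _)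
  refine ⟨⟨fejerMean H N, natDegree_fejerMean_le H N, diskNorm_le fun z hz => ?_⟩,
    diskNorm_le fun z hz => ?_⟩
  · have := hmono (N + 1) (Nat.le_succ N) z hz
    rw [Nat.add_sub_cancel] at this
    linarith
  · have h1 := hmono (2 * N) (by omega) z hz
    have h2 := hmono N le_rfl z hz
    rw [valleePoussinMean, Polynomial.eval_sub, Polynomial.eval_mul, Polynomial.eval_ofNat]
    calc _ = ‖2 * (H z - (fejerMean H (2 * N - 1)).eval z) -
          (H z - (fejerMean H (N - 1)).eval z)‖ := by congr 1; ring
      _ ≤ 2 * ‖H z - (fejerMean H (2 * N - 1)).eval z‖ +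
          ‖H z - (fejerMean H (N - 1)).eval z‖ := by
          refine (norm_sub_le _ _).trans (le_of_eq ?_)
          rw [norm_mul, Complex.norm_ofNat]
      _ ≤ 3 * C * (N : ℝ) ^ (-a) := by linarith

/-! ### The spectral factors and the filters -/

section Factors

variable {Φ : ℝ → ℝ}

theorem differentiableOn_outerExponent
    (hu : IntervalIntegrable (fun ω => (Real.log (Φ ω) : ℂ)) MeasureTheory.volume
      (-Real.pi) Real.pi) : DifferentiableOn ℂ (outerExponent Φ) (Metric.ball 0 1) :=
  (((differentiableOn_cauchyTransform hu).const_mul 2).add_const _).congr fun _ hz =>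
    outerExponent_eq_cauchyTransform hu (by simpa using hz)

theorem holderAlong_outerExponent {a : ℝ} (ha0 : 0 < a) (ha1 : a < 1)
    (hu : HolderAlong circlePt (Set.Ico (-Real.pi) Real.pi) a
      (fun ω => (Real.log (Φ ω) : ℂ))) :
    HolderAlong id (Metric.ball (0 : ℂ) 1) a (outerExponent Φ) :=
  ((hu.cauchyTransform ha0 ha1).const_mul_add 2 _).congr fun _ hz =>
    outerExponent_eq_cauchyTransform (hu.intervalIntegrable ha0) (by simpa using hz)

theorem norm_le_one_of_mem_ball : ∀ z ∈ Metric.ball (0 : ℂ) 1, ‖id z‖ ≤ 1 := fun z hz => by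
  simpa using (mem_ball_zero_iff.1 hz).le

/-- The `+ 0` matches the shape of `HolderAlong.const_mul_add`. -/
theorem factorPlus_eq (Φ : ℝ → ℝ) :
    factorPlus Φ = fun z => Complex.exp (2⁻¹ * outerExponent Φ z + 0) := by
  funext z; rw [factorPlus]; congr 1; ring

theorem whiteningFilter_eq (Φ : ℝ → ℝ) :
    whiteningFilter Φ = fun z => Complex.exp (-2⁻¹ * outerExponent Φ z + 0) := by
  funext z; rw [whiteningFilter, factorPlus, one_div, ← Complex.exp_neg]; congr 1; ring

theorem differentiableOn_whiteningFilter
    (hu : IntervalIntegrable (fun ω => (Real.log (Φ ω) : ℂ)) MeasureTheory.volume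
      (-Real.pi) Real.pi) : DifferentiableOn ℂ (whiteningFilter Φ) (Metric.ball 0 1) := by
  rw [whiteningFilter_eq]
  exact (((differentiableOn_outerExponent hu).const_mul _).add_const _).cexp

section

variable {a : ℝ} (ha0 : 0 < a) (ha1 : a < 1)
  (hu : HolderAlong circlePt (Set.Ico (-Real.pi) Real.pi) a (fun ω => (Real.log (Φ ω) : ℂ)))
include ha0 ha1 hu

theorem holderAlong_factorPlus : HolderAlong id (Metric.ball (0 : ℂ) 1) a (factorPlus Φ) := by
  rw [factorPlus_eq]
  exact ((holderAlong_outerExponent ha0 ha1 hu).const_mul_add _ _).cexp ha0.le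
    norm_le_one_of_mem_ball

theorem holderAlong_whiteningFilter :
    HolderAlong id (Metric.ball (0 : ℂ) 1) a (whiteningFilter Φ) := by
  rw [whiteningFilter_eq]
  exact ((holderAlong_outerExponent ha0 ha1 hu).const_mul_add _ _).cexp ha0.le
    norm_le_one_of_mem_ball

theorem tendsto_factorPlusBdry (ω : ℝ) :
    Tendsto (fun r : ℝ => factorPlus Φ (r * circlePt ω)) (𝓝[<] 1) (𝓝 (factorPlusBdry Φ ω)) :=
  (holderAlong_factorPlus ha0 ha1 hu).tendsto_limUnder_radial ha0 ω

/-- Reflection in the circle sends `r e^{iω}` to `r⁻¹ e^{iω}`, so the outer radial limit is the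
conjugate of the inner one. -/
theorem tendsto_factorMinus (ω : ℝ) :
    Tendsto (fun r : ℝ => factorMinus Φ (r * circlePt ω)) (𝓝[>] 1)
      (𝓝 (conj (factorPlusBdry Φ ω))) := by
  have hinv : Tendsto (fun r : ℝ => r⁻¹) (𝓝[>] 1) (𝓝[<] 1) := by
    refine tendsto_nhdsWithin_iff.2 ⟨?_, ?_⟩
    · have := (continuousAt_inv₀ (one_ne_zero (α := ℝ))).tendsto
      rw [inv_one] at this
      exact this.mono_left nhdsWithin_le_nhds
    · filter_upwards [self_mem_nhdsWithin] with r hr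
      exact inv_lt_one_of_one_lt₀ (Set.mem_Ioi.1 hr)
  have h := (Complex.continuous_conj.tendsto _).comp
    ((tendsto_factorPlusBdry ha0 ha1 hu ω).comp hinv)
  refine h.congr fun r => ?_
  simp only [Function.comp, factorMinus, map_mul, Complex.conj_ofReal, conj_circlePt]
  rw [one_div, mul_inv, inv_inv, Complex.ofReal_inv]

theorem factorMinusBdry_eq (ω : ℝ) : factorMinusBdry Φ ω = conj (factorPlusBdry Φ ω) :=
  (tendsto_factorMinus ha0 ha1 hu ω).limUnder_eq

/-- The product is the squared modulus of the boundary value of `Φ₊`, and inside the disk `|Φ₊|² =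
exp (Re outerExponent)`, which tends to `exp (log Φ)`. -/
theorem factorPlusBdry_mul_factorMinusBdry {ω : ℝ} (hω : ω ∈ Set.Ico (-Real.pi) Real.pi)
    (hpos : 0 < Φ ω) : (Φ ω : ℂ) = factorPlusBdry Φ ω * factorMinusBdry Φ ω := by
  rw [factorMinusBdry_eq ha0 ha1 hu, Complex.mul_conj, Complex.normSq_eq_norm_sq]
  congr 1
  have h1 := (Real.continuous_exp.tendsto _).comp (tendsto_re_outerExponent ha0 ha1 hu hω)
  rw [Real.exp_log hpos] at h1
  refine tendsto_nhds_unique h1 (((tendsto_factorPlusBdry ha0 ha1 hu ω).norm.pow 2).congr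
    fun r => ?_)
  rw [← norm_pow, factorPlus_sq, outerFunction, Complex.norm_exp, Function.comp]

theorem limUnder_whiteningFilter {ω : ℝ} (hω : ω ∈ Set.Ico (-Real.pi) Real.pi)
    (hpos : 0 < Φ ω) :
    (limUnder (𝓝[<] (1 : ℝ)) fun r : ℝ => whiteningFilter Φ (r * circlePt ω)) =
      (factorPlusBdry Φ ω)⁻¹ := by
  have hne : factorPlusBdry Φ ω ≠ 0 := fun h0 => by
    have := factorPlusBdry_mul_factorMinusBdry ha0 ha1 hu hω hpos
    rw [h0, zero_mul] at this
    exact hpos.ne' (by exact_mod_cast this)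
  refine Tendsto.limUnder_eq (((tendsto_factorPlusBdry ha0 ha1 hu ω).inv₀ hne).congr fun r => ?_)
  rw [whiteningFilter, one_div]

/-- On the circle `1 / Φ₋` is the conjugate boundary value of the whitening filter, already known to
be Hölder, so no quotient has to be estimated. -/
theorem holderAlong_div_factorMinusBdry {Ψ : ℝ → ℂ}
    (hΨ : HolderAlong circlePt (Set.Ico (-Real.pi) Real.pi) a Ψ)
    (hpos : ∀ ω ∈ Set.Ico (-Real.pi) Real.pi, 0 < Φ ω) :
    HolderAlong circlePt (Set.Ico (-Real.pi) Real.pi) a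
      (fun ω => Ψ ω / factorMinusBdry Φ ω) := by
  have h := hΨ.mul (((holderAlong_whiteningFilter ha0 ha1 hu).limUnder_radial ha0
    (Set.Ico (-Real.pi) Real.pi)).star_conj) ha0.le fun x _ => (norm_circlePt x).le
  refine h.congr fun ω hω => ?_
  rw [limUnder_whiteningFilter ha0 ha1 hu hω (hpos ω hω), factorMinusBdry_eq ha0 ha1 hu,
    map_inv₀, div_eq_mul_inv]

end

end Factors

end WienerFIR

end

theorem mainTheorem3 (α : ℝ≥0) (hα0 : 0 < α) (hα1 : α < 1)
    (Φ : ℝ → ℝ) (Ψ : ℝ → ℂ) (hΦ : HolderSpectrum α Φ) (hΨ : HolderSpectrum α Ψ)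
    (hΦpos : ∀ ω ∈ Set.Ico (-Real.pi) Real.pi, 0 < Φ ω) :
    -- the boundary values of the spectral factors exist, and they factorize the spectrum
    (∀ ω ∈ Set.Ico (-Real.pi) Real.pi,
      Tendsto (fun r : ℝ => factorPlus Φ (r * circlePt ω)) (𝓝[<] 1) (𝓝 (factorPlusBdry Φ ω)) ∧
      Tendsto (fun r : ℝ => factorMinus Φ (r * circlePt ω)) (𝓝[>] 1) (𝓝 (factorMinusBdry Φ ω)) ∧
      (Φ ω : ℂ) = factorPlusBdry Φ ω * factorMinusBdry Φ ω) ∧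
    -- FIR approximation of the three filters
    (∀ H ∈ ({whiteningFilter Φ, estimationFilter Φ Ψ, wienerFilter Φ Ψ} : Set (ℂ → ℂ)),
      ∃ C : ℝ, ∀ N : ℕ, 1 ≤ N →
        (∃ P : ℂ[X], P.natDegree ≤ N ∧
          diskNorm (fun z => H z - P.eval z) ≤ ENNReal.ofReal (C * (N : ℝ) ^ (-(α : ℝ)))) ∧
        diskNorm (fun z => H z - (valleePoussinMean H N).eval z) ≤
          ENNReal.ofReal (C * (N : ℝ) ^ (-(α : ℝ)))) := by
  have ha0 : (0 : ℝ) < α := by exact_mod_cast hα0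
  have ha1 : (α : ℝ) < 1 := by exact_mod_cast hα1
  have hlog := hΦ.holderAlong_log hα0 hΦpos
  have hint := hlog.intervalIntegrable ha0
  have hΓ := holderAlong_div_factorMinusBdry ha0 ha1 hlog hΨ.holderAlong hΦpos
  have hest : ∀ z ∈ Metric.ball (0 : ℂ) 1, estimationFilter Φ Ψ z =
      cauchyTransform (fun ω => Ψ ω / factorMinusBdry Φ ω) z := fun z hz =>
    positivePart_eq_cauchyTransform (hΓ.intervalIntegrable ha0) (by simpa using hz)
  have hWd := differentiableOn_whiteningFilter hint
  have hWh := holderAlong_whiteningFilter ha0 ha1 hlog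
  have hEd : DifferentiableOn ℂ (estimationFilter Φ Ψ) (Metric.ball 0 1) :=
    (differentiableOn_cauchyTransform (hΓ.intervalIntegrable ha0)).congr hest
  have hEh : HolderAlong id (Metric.ball (0 : ℂ) 1) α (estimationFilter Φ Ψ) :=
    (hΓ.cauchyTransform ha0 ha1).congr hest
  refine ⟨fun ω hω => ⟨tendsto_factorPlusBdry ha0 ha1 hlog ω, ?_,
    factorPlusBdry_mul_factorMinusBdry ha0 ha1 hlog hω (hΦpos ω hω)⟩, ?_⟩
  · rw [factorMinusBdry_eq ha0 ha1 hlog]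
    exact tendsto_factorMinus ha0 ha1 hlog ω
  · rintro H (rfl | rfl | rfl)
    · exact exists_fir_approximation ha0 ha1 hWd hWh
    · exact exists_fir_approximation ha0 ha1 hEd hEh
    · exact exists_fir_approximation ha0 ha1 (hWd.mul hEd)
        (hWh.mul hEh ha0.le norm_le_one_of_mem_ball)
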